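/- **Theorem (Minimum Consistent Subset is FPT parameterized by vertex cover number).** Let $G$ be a finite simple graph with a vertex colouring $\chi\colon V(G)\to[c]$ (not necessarily proper or surjective). Let $d(u,v)$ denote the shortest-path distance in $G$, with $d(u,v)=\infty$ if $u$ and $v$ lie in different components. For $v\in V(G)$ and $U\subseteq V(G)$ put $d(v,U)=\min_{u\in U}d(v,u)$ (which is $\infty$ for $U=\emptyset$) and $\mathrm{NN}(v,U)=\{u\in U : d(v,u)=d(v,U)\}$. A set $S\subseteq V(G)$ is a *consistent subset* for $(G,\chi)$ if $\chi(v)\in\chi(\mathrm{NN}(v,S))$ for every $v\in V(G)$, and a *minimum consistent subset* if in addition it has the smallest cardinality among all consistent subsets. There is a deterministic algorithm (a program for a random access machine with unit-cost memory access, addition, truncated subtraction and comparison with zero) that, given any such pair $(G,\chi)$, computes a minimum consistent subset for $(G,\chi)$ in time $k^{O(k)}\cdot\mathrm{poly}(n,c)$, where $n=|V(G)|$, $c$ is the number of colours and $k$ is the vertex cover number of $G$, that is, the minimum size of a set of vertices that meets every edge. Precisely, there are constants $\alpha,\beta,\delta\in\mathbb N$ such that on every instance the algorithm halts after at most $$\alpha\cdot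 k^{\beta k}\cdot(n+c+1)^{\delta}$$ steps, where $0^0=1$. The graph is given by its adjacency matrix; neither $k$ nor a vertex cover is part of the input. In particular, the problem is fixed-parameter tractable with respect to $k$, with a running time that is polynomial in the number of colours. -/

import Mathlib

/-! ### Consistent subsets of vertex-coloured graphs -/

namespace MCS

variable {V C : Type*}

/-- The distance `d(v, U) = min_{u ∈ U} d(v, u)`. Distances are shortest-path distances, with the
value `⊤` between vertices that are not joined by a path (and for `U = ∅`). -/
noncomputable def distTo (G : SimpleGraph V) (v : V) (U : Set V) : ℕ∞ :=
  ⨅ u ∈ U, G.edist v u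

/-- The set `NN(v, U)` of nearest neighbours of `v` in `U`. -/
def nearest (G : SimpleGraph V) (v : V) (U : Set V) : Set V :=
  {u ∈ U | G.edist v u = distTo G v U}

/-- `S` is a consistent subset for `(G, χ)`: the colour of every vertex is present among the
colours of its nearest neighbours in `S`. -/
def IsConsistent (G : SimpleGraph V) (χ : V → C) (S : Set V) : Prop :=
  ∀ v, χ v ∈ χ '' nearest G v S

/-- `S` is a minimum consistent subset for `(G, χ)`. -/
def IsMinimumConsistent (G : SimpleGraph V) (χ : V → C) (S : Finset V) : Prop :=
  IsConsistent G χ (S : Set V) ∧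
    ∀ T : Finset V, IsConsistent G χ (T : Set V) → S.card ≤ T.card

end MCS

/-! ### Random access machines

A deterministic random access machine with unit costs. Its memory consists of registers and of
one-dimensional arrays, all with natural numbers as entries; array positions are computed at run
time. The only arithmetic operations are addition and truncated subtraction. There is no
multiplication, so one operation at most doubles the largest number in use, and the number of steps
is polynomially related to the running time of a Turing machine. Programs are given in structured
form. -/

namespace RAM

/-- The memory: register `i` holds `reg i`, and position `j` of array `a` holds `arr a j`. -/
structure State where
  reg : ℕ → ℕ
  arr : ℕ → ℕ → ℕ

/-- Arithmetic expressions. In `arr a e`, the name `a` of the array is fixed by the program, and the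
position `e` is computed. -/
inductive Expr where
  | lit (m : ℕ)
  | reg (i : ℕ)
  | arr (a : ℕ) (e : Expr)
  | add (e₁ e₂ : Expr)
  | sub (e₁ e₂ : Expr)

/-- The value of an expression. -/
def Expr.eval (s : State) : Expr → ℕ
  | .lit m => m
  | .reg i => s.reg i
  | .arr a e => s.arr a (e.eval s)
  | .add e₁ e₂ => e₁.eval s + e₂.eval s
  | .sub e₁ e₂ => e₁.eval s - e₂.eval s

/-- The number of steps needed to evaluate an expression: one for each constant, each memory access
and each arithmetic operation. -/
def Expr.cost : Expr → ℕ
  | .lit _ => 1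
  | .reg _ => 1
  | .arr _ e => e.cost + 1
  | .add e₁ e₂ => e₁.cost + e₂.cost + 1
  | .sub e₁ e₂ => e₁.cost + e₂.cost + 1

/-- Programs. The test `e` of a conditional or of a loop succeeds if the value of `e` is not `0`. -/
inductive Program where
  | skip
  | setReg (i : ℕ) (e : Expr)
  | setArr (a : ℕ) (pos e : Expr)
  | seq (p q : Program)
  | ite (e : Expr) (p q : Program)
  | loop (e : Expr) (p : Program)

/-- `Runs p s s' t`: the program `p`, started in the memory state `s`, halts in the memory state
`s'` after exactly `t` steps. -/
inductive Runs : Program → State → State → ℕ → Prop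
  | skip (s : State) : Runs .skip s s 1
  | setReg (i : ℕ) (e : Expr) (s : State) :
      Runs (.setReg i e) s { s with reg := Function.update s.reg i (e.eval s) } (e.cost + 1)
  | setArr (a : ℕ) (pos e : Expr) (s : State) :
      Runs (.setArr a pos e) s
        { s with arr := Function.update s.arr a
                          (Function.update (s.arr a) (pos.eval s) (e.eval s)) }
        (pos.cost + e.cost + 1)
  | seq {p q : Program} {s s' s'' : State} {t t' : ℕ} :
      Runs p s s' t → Runs q s' s'' t' → Runs (.seq p q) s s'' (t + t')
  | ite_true {e : Expr} {p q : Program} {s s' : State} {t : ℕ} :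
      e.eval s ≠ 0 → Runs p s s' t → Runs (.ite e p q) s s' (e.cost + 1 + t)
  | ite_false {e : Expr} {p q : Program} {s s' : State} {t : ℕ} :
      e.eval s = 0 → Runs q s s' t → Runs (.ite e p q) s s' (e.cost + 1 + t)
  | loop_stop {e : Expr} {p : Program} {s : State} :
      e.eval s = 0 → Runs (.loop e p) s s (e.cost + 1)
  | loop_step {e : Expr} {p : Program} {s s' s'' : State} {t t' : ℕ} :
      e.eval s ≠ 0 → Runs p s s' t → Runs (.loop e p) s' s'' t' →
        Runs (.loop e p) s s'' (e.cost + 1 + t + t')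

end RAM

namespace MCS

open Classical in
/-- The memory that holds the instance `(G, χ)`: the number of vertices in register `0`, the number
of colours in register `1`, the colours of the vertices in array `0`, and the adjacency matrix, row
by row, in array `1`. All other entries are `0`. -/
noncomputable def input {n c : ℕ} (G : SimpleGraph (Fin n)) (χ : Fin n → Fin c) : RAM.State where
  reg := fun i => if i = 0 then n else if i = 1 then c else 0
  arr := fun a j =>
    if a = 0 then (if h : j < n then (χ ⟨j, h⟩ : ℕ) else 0)
    else if a = 1 then
      (if ∃ u v : Fin n, G.Adj u v ∧ j = (u : ℕ) * n + (v : ℕ) then 1 else 0)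
    else 0

/-- The first `n` entries of array `2` are the characteristic vector of `S`. -/
def IsOutput {n : ℕ} (s : RAM.State) (S : Finset (Fin n)) : Prop :=
  ∀ v : Fin n, s.arr 2 (v : ℕ) = if v ∈ S then 1 else 0

end MCS

/-! A greedy maximal matching gives a vertex cover X with K = |X| ≤ 2k. All finite distances are at
most 2K (`edist_le_two_mul_card`), so they can be capped at M = 2K + 1, which stands for ∞. A vertex
outside X has all its neighbours in X. Unless it lies in S or is isolated, it therefore finds its
nearest elements of S through those neighbours that are closest to S. Hence consistency of S can be
certified by numbers d(x), x ∈ X: no element of S is closer to x than d(x), and each v ∉ S has, for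
a suitable x, an element of S of its own colour at distance exactly d(x) from x; an isolated v ∉ X
only needs its colour to occur in S. Completeness is `exists_content_of_isConsistent`, soundness is
`isConsistent_of_content`. The latter uses d only as a lower bound, so d may be guessed without
checking that it is the true distance.

Once d is fixed, the colour classes no longer interact. Each is a covering problem with L = K + 1
items: one per vertex of X, and one for the mere occurrence of the colour. Knowing which items are
hit forces certain vertices into S; the hit items that these miss are partitioned according to the
vertex that hits them, and one vertex per block suffices (`exists_cand_le`). So an optimum for each
colour is found among B ^ L codes, B = 2K + 4, and d is coded in the same way. Codes are searched
for each colour separately and the minima are added, which keeps the time polynomial in the number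
of colours.

For the running time, `Comp` collects the functions computable in time polynomial in the `weight` of
the memory; it is closed under arithmetic, case distinction, bounded sums and bounded quantifiers.
Since a register holds B ^ L, exhaustive search over codes is a bounded quantifier, and
`weight_prepared` turns the polynomial bound into k^{O(k)} · poly(n, c). -/

open Finset

/-! ### Polynomial-time computable functions on the random access machine -/

namespace RAM

/-- A type of tuples of local variables: `depth` many variables, the `i`-th one being `loc γ i`. -/
class Ctx (Γ : Type) where
  depth : ℕ
  loc : Γ → ℕ → ℕ

instance : Ctx Unit := ⟨0, fun _ _ => 0⟩

instance {Γ : Type} [Ctx Γ] : Ctx (Γ × ℕ) :=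
  ⟨Ctx.depth Γ + 1, fun p i => if i = Ctx.depth Γ then p.2 else Ctx.loc p.1 i⟩

/-- The first 16 registers are global; loops are bounded by their values. -/
def weight (m : State) : ℕ := 1 + ∑ i ∈ range 16, m.reg i

lemma one_le_weight (m : State) : 1 ≤ weight m := Nat.le_add_right _ _

lemma reg_lt_weight (m : State) {b : ℕ} (hb : b < 16) : m.reg b < weight m := by
  have : m.reg b ≤ ∑ i ∈ range 16, m.reg i :=
    single_le_sum (f := m.reg) (fun _ _ => Nat.zero_le _) (mem_range.2 hb)
  unfold weight; omega

/-- The states agree on the arrays and on the global registers. -/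
def Agree (m s : State) : Prop := s.arr = m.arr ∧ ∀ i < 16, s.reg i = m.reg i

/-- The state `s` represents the memory `m` and the local variables `γ`, which are stored in the
registers given by `ℓ`, all of them below `q`. -/
structure Fits {Γ : Type} [Ctx Γ] (ℓ : ℕ → ℕ) (q : ℕ) (m : State) (γ : Γ) (s : State) : Prop where
  le : 16 ≤ q
  lt : ∀ i < Ctx.depth Γ, ℓ i < q
  agree : Agree m s
  loc : ∀ i < Ctx.depth Γ, s.reg (ℓ i) = Ctx.loc γ i

/-- The states differ at most in registers from `q` on. -/
def SameBelow (q : ℕ) (s s' : State) : Prop := s'.arr = s.arr ∧ ∀ i < q, s'.reg i = s.reg i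

lemma SameBelow.trans {q : ℕ} {s s' s'' : State} (h : SameBelow q s s') (h' : SameBelow q s' s'') :
    SameBelow q s s'' :=
  ⟨h'.1.trans h.1, fun i hi => (h'.2 i hi).trans (h.2 i hi)⟩

lemma SameBelow.mono {q q' : ℕ} {s s' : State} (h : SameBelow q' s s') (hq : q ≤ q') :
    SameBelow q s s' :=
  ⟨h.1, fun i hi => h.2 i (hi.trans_le hq)⟩

lemma SameBelow.update (q : ℕ) (s : State) {i : ℕ} (hi : q ≤ i) (x : ℕ) :
    SameBelow q s { s with reg := Function.update s.reg i x } :=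
  ⟨rfl, fun _ hj => Function.update_of_ne (by omega) _ _⟩

lemma Agree.sameBelow {m s s' : State} {q : ℕ} (h : Agree m s) (hq : 16 ≤ q)
    (h' : SameBelow q s s') : Agree m s' :=
  ⟨h'.1.trans h.1, fun i hi => (h'.2 i (by omega)).trans (h.2 i hi)⟩

section Comp

variable {Γ : Type} [Ctx Γ]

lemma Fits.sameBelow {ℓ : ℕ → ℕ} {q : ℕ} {m : State} {γ : Γ} {s s' : State}
    (h : Fits ℓ q m γ s) (h' : SameBelow q s s') : Fits ℓ q m γ s' :=
  ⟨h.le, h.lt, h.agree.sameBelow h.le h', fun i hi => (h'.2 _ (h.lt i hi)).trans (h.loc i hi)⟩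

lemma Fits.mono {ℓ : ℕ → ℕ} {q q' : ℕ} {m : State} {γ : Γ} {s : State}
    (h : Fits ℓ q m γ s) (hq : q ≤ q') : Fits ℓ q' m γ s :=
  ⟨h.le.trans hq, fun i hi => (h.lt i hi).trans_le hq, h.agree, h.loc⟩

lemma Fits.fst {ℓ : ℕ → ℕ} {q : ℕ} {m : State} {γ : Γ × ℕ} {s : State}
    (h : Fits ℓ q m γ s) : Fits ℓ q m γ.1 s := by
  refine ⟨h.le, fun i hi => h.lt i (Nat.lt_succ_of_lt hi), h.agree, fun i hi => ?_⟩
  rw [h.loc i (Nat.lt_succ_of_lt hi)]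
  exact if_neg (Nat.ne_of_lt hi)

lemma Fits.snd {ℓ : ℕ → ℕ} {q : ℕ} {m : State} {γ : Γ × ℕ} {s : State}
    (h : Fits ℓ q m γ s) : ℓ (Ctx.depth Γ) < q ∧ s.reg (ℓ (Ctx.depth Γ)) = γ.2 :=
  ⟨h.lt _ (Nat.lt_succ_self _), (h.loc _ (Nat.lt_succ_self _)).trans (if_pos rfl)⟩

/-- This binds a loop counter: its register becomes the newest local variable, and scratch space
starts after it. -/
lemma Fits.push {ℓ : ℕ → ℕ} {q r j : ℕ} {m : State} {γ : Γ} {s : State}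
    (h : Fits ℓ q m γ s) (hr : q ≤ r) (hj : s.reg r = j) :
    Fits (Function.update ℓ (Ctx.depth Γ) r) (r + 1) m (γ, j) s := by
  have key : ∀ i < Ctx.depth Γ + 1, i = Ctx.depth Γ ∨ i < Ctx.depth Γ := fun i hi => by omega
  refine ⟨by have := h.le; omega, fun i hi => ?_, h.agree, fun i hi => ?_⟩
  · rcases key i hi with rfl | hi
    · simp
    · rw [Function.update_of_ne (by omega)]
      have := h.lt i hi
      omega
  · rcases key i hi with rfl | hi
    · simp only [Function.update_self, hj]
      exact (if_pos rfl).symm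
    · rw [Function.update_of_ne (by omega), h.loc i hi]
      exact (if_neg (Nat.ne_of_lt hi)).symm

/-- The function `f` of the memory and of local variables is computed by a program whose running
time is polynomial in the weight of the memory, and which only changes the registers from `q` on.
The result is put into register `q`. -/
def Comp (f : State → Γ → ℕ) : Prop :=
  ∃ (p : (ℕ → ℕ) → ℕ → Program) (C e : ℕ), ∀ ℓ q m γ s, Fits ℓ q m γ s →
    ∃ s' t, Runs (p ℓ q) s s' t ∧ t ≤ C * weight m ^ e ∧ s'.reg q = f m γ ∧ SameBelow q s s'

/-- The predicate `P` can be decided in polynomial time. -/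
def CompP (P : State → Γ → Prop) : Prop :=
  Comp fun m γ => open Classical in if P m γ then 1 else 0

lemma le_pow_weight {C C' e e' t : ℕ} {m : State} (h : t ≤ C * weight m ^ e) (hC : C ≤ C')
    (he : e ≤ e') : t ≤ C' * weight m ^ e' :=
  h.trans (Nat.mul_le_mul hC (Nat.pow_le_pow_right (one_le_weight m) he))

namespace Comp

lemma expr {f : State → Γ → ℕ} (E : (ℕ → ℕ) → Expr) (C : ℕ) (hC : ∀ ℓ, (E ℓ).cost ≤ C)
    (h : ∀ ℓ q m γ s, Fits ℓ q m γ s → (E ℓ).eval s = f m γ) : Comp f := by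
  refine ⟨fun ℓ q => .setReg q (E ℓ), C + 1, 0,
    fun ℓ q m γ s hs => ⟨_, _, .setReg _ _ _, ?_, ?_, ?_⟩⟩
  · have := hC ℓ
    simpa using this
  · simp [h ℓ q m γ s hs]
  · exact .update _ _ le_rfl _

lemma const (a : ℕ) : Comp fun _ (_ : Γ) => a :=
  expr (fun _ => .lit a) 1 (fun _ => le_rfl) fun _ _ _ _ _ _ => rfl

lemma reg (b : ℕ) (hb : b < 16 := by norm_num) : Comp fun m (_ : Γ) => m.reg b :=
  expr (fun _ => .reg b) 1 (fun _ => le_rfl) fun _ _ _ _ _ h => h.agree.2 b hb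

lemma var : Comp fun _ (γ : Γ × ℕ) => γ.2 :=
  expr (fun ℓ => .reg (ℓ (Ctx.depth Γ))) 1 (fun _ => le_rfl) fun _ _ _ _ _ h => h.snd.2

lemma weaken {f : State → Γ → ℕ} (hf : Comp f) : Comp fun m (γ : Γ × ℕ) => f m γ.1 := by
  obtain ⟨p, C, e, h⟩ := hf
  exact ⟨p, C, e, fun ℓ q m γ s hs => h ℓ q m γ.1 s hs.fst⟩

lemma arr (a : ℕ) {f : State → Γ → ℕ} (hf : Comp f) : Comp fun m γ => m.arr a (f m γ) := by
  obtain ⟨p, C, e, h⟩ := hf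
  refine ⟨fun ℓ q => .seq (p ℓ q) (.setReg q (.arr a (.reg q))), C + 3, e, fun ℓ q m γ s hs => ?_⟩
  obtain ⟨s', t, hr, ht, hv, hb⟩ := h ℓ q m γ s hs
  refine ⟨_, _, .seq hr (.setReg _ _ _), ?_, ?_, hb.trans (.update _ _ le_rfl _)⟩
  · have := Nat.one_le_pow e _ (one_le_weight m)
    simp only [Expr.cost]
    nlinarith
  · simp [Expr.eval, hv, hb.1, hs.agree.1]

lemma binop {f g : State → Γ → ℕ} (hf : Comp f) (hg : Comp g) (op : ℕ → ℕ → ℕ)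
    (E : Expr → Expr → Expr)
    (hE : ∀ s a b, (E a b).eval s = op (a.eval s) (b.eval s))
    (hC : ∀ a b, (E a b).cost = a.cost + b.cost + 1) :
    Comp fun m γ => op (f m γ) (g m γ) := by
  obtain ⟨p, C, e, h⟩ := hf
  obtain ⟨p', C', e', h'⟩ := hg
  -- The first operand stays in register q while the second is computed from q + 1 on.
  refine ⟨fun ℓ q => .seq (p ℓ q) (.seq (p' ℓ (q + 1)) (.setReg q (E (.reg q) (.reg (q + 1))))),
    C + C' + 4, e + e', fun ℓ q m γ s hs => ?_⟩
  obtain ⟨s', t, hr, ht, hv, hb⟩ := h ℓ q m γ s hs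
  obtain ⟨s'', t', hr', ht', hv', hb'⟩ :=
    h' ℓ (q + 1) m γ s' ((hs.sameBelow hb).mono (Nat.le_succ q))
  refine ⟨_, _, .seq hr (.seq hr' (.setReg _ _ _)), ?_, ?_,
    hb.trans ((hb'.mono (Nat.le_succ q)).trans (.update _ _ le_rfl _))⟩
  · have := Nat.one_le_pow (e + e') _ (one_le_weight m)
    have h1 := le_pow_weight (e' := e + e') ht le_rfl (by omega)
    have h2 := le_pow_weight (e' := e + e') ht' le_rfl (by omega)
    simp only [Expr.cost, hC]
    nlinarith
  · simp [hE, Expr.eval, hv', hb'.2 q (Nat.lt_succ_self q), hv]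

lemma add {f g : State → Γ → ℕ} (hf : Comp f) (hg : Comp g) : Comp fun m γ => f m γ + g m γ :=
  hf.binop hg (· + ·) .add (fun _ _ _ => rfl) fun _ _ => rfl

lemma sub {f g : State → Γ → ℕ} (hf : Comp f) (hg : Comp g) : Comp fun m γ => f m γ - g m γ :=
  hf.binop hg (· - ·) .sub (fun _ _ _ => rfl) fun _ _ => rfl

lemma ite {P : State → Γ → Prop} [∀ m γ, Decidable (P m γ)] {f g : State → Γ → ℕ}
    (hP : CompP P) (hf : Comp f) (hg : Comp g) : Comp fun m γ => if P m γ then f m γ else g m γ := by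
  obtain ⟨p₀, C₀, e₀, h₀⟩ := hP
  obtain ⟨p, C, e, h⟩ := hf
  obtain ⟨p', C', e', h'⟩ := hg
  refine ⟨fun ℓ q => .seq (p₀ ℓ q) (.ite (.reg q) (p ℓ q) (p' ℓ q)),
    C₀ + C + C' + 2, e₀ + e + e', fun ℓ q m γ s hs => ?_⟩
  obtain ⟨s₁, t₁, hr₁, ht₁, hv₁, hb₁⟩ := h₀ ℓ q m γ s hs
  have hw := Nat.one_le_pow (e₀ + e + e') _ (one_le_weight m)
  have w₁ := le_pow_weight (e' := e₀ + e + e') ht₁ le_rfl (by omega)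
  by_cases hp : P m γ
  · obtain ⟨s₂, t₂, hr₂, ht₂, hv₂, hb₂⟩ := h ℓ q m γ s₁ (hs.sameBelow hb₁)
    refine ⟨_, _, .seq hr₁ (.ite_true ?_ hr₂), ?_, ?_, hb₁.trans hb₂⟩
    · simp [Expr.eval, hv₁, hp]
    · have w₂ := le_pow_weight (e' := e₀ + e + e') ht₂ le_rfl (by omega)
      simp only [Expr.cost]
      nlinarith
    · simp [hv₂, hp]
  · obtain ⟨s₂, t₂, hr₂, ht₂, hv₂, hb₂⟩ := h' ℓ q m γ s₁ (hs.sameBelow hb₁)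
    refine ⟨_, _, .seq hr₁ (.ite_false ?_ hr₂), ?_, ?_, hb₁.trans hb₂⟩
    · simp [Expr.eval, hv₁, hp]
    · have w₂ := le_pow_weight (e' := e₀ + e + e') ht₂ le_rfl (by omega)
      simp only [Expr.cost]
      nlinarith
    · simp [hv₂, hp]

end Comp

/-- A loop in which register `r` counts up to the value of register `b`. -/
def forLoop (r b : ℕ) (p : Program) : Program :=
  .seq (.setReg r (.lit 0))
    (.loop (.sub (.reg b) (.reg r)) (.seq p (.setReg r (.add (.reg r) (.lit 1)))))

/-- `I j` is the invariant before round j. Beyond its body, a round costs 4 for the test and 4 for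
the increment; the final 6 pays for the initialisation and the last test. -/
lemma forLoop_runs {r b : ℕ} {p : Program} {N T : ℕ} (I : ℕ → State → Prop)
    (hI : ∀ j s, j ≤ N → I j s → s.reg r = j ∧ s.reg b = N)
    (step : ∀ j s, j < N → I j s → ∃ s' t, Runs p s s' t ∧ t ≤ T ∧
      s'.reg r = j ∧ I (j + 1) { s' with reg := Function.update s'.reg r (j + 1) })
    {s : State} (h0 : I 0 { s with reg := Function.update s.reg r 0 }) :
    ∃ s' t, Runs (forLoop r b p) s s' t ∧ t ≤ N * (T + 8) + 6 ∧ I N s' := by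
  have main : ∀ i ≤ N, ∀ s, I (N - i) s → ∃ s' t,
      Runs (.loop (.sub (.reg b) (.reg r)) (.seq p (.setReg r (.add (.reg r) (.lit 1))))) s s' t ∧
        t ≤ i * (T + 8) + 4 ∧ I N s' := by
    intro i
    induction i with
    | zero =>
      intro _ s hs
      obtain ⟨h1, h2⟩ := hI _ s (Nat.sub_le _ _) hs
      refine ⟨s, 3 + 1, ?_, by omega, hs⟩
      constructor
      simp [Expr.eval, h1, h2]
    | succ i ih =>
      intro hi s hs
      obtain ⟨h1, h2⟩ := hI _ s (Nat.sub_le _ _) hs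
      obtain ⟨s', t, hr, ht, hv, hs'⟩ := step _ s (by omega) hs
      have e : N - (i + 1) + 1 = N - i := by omega
      rw [e] at hs'
      obtain ⟨s'', t', hr', ht', hs''⟩ := ih (by omega) _ hs'
      refine ⟨s'', _, .loop_step (t' := t') ?_ (.seq hr (.setReg _ _ _)) ?_, ?_, hs''⟩
      · simp only [Expr.eval, h1, h2]
        omega
      · simpa only [Expr.eval, hv, e] using hr'
      · simp only [Expr.cost]
        nlinarith
  obtain ⟨s', t, hr, ht, hs'⟩ := main N le_rfl _ (by simpa using h0)
  refine ⟨s', _, .seq (.setReg _ _ _) hr, ?_, hs'⟩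
  simp only [Expr.cost]
  omega

namespace Comp

lemma sum (b : ℕ) {F : State → Γ → ℕ → ℕ} (hF : Comp fun m (γ : Γ × ℕ) => F m γ.1 γ.2)
    (hb : b < 16 := by norm_num) : Comp fun m γ => ∑ j ∈ range (m.reg b), F m γ j := by
  obtain ⟨p, C, e, h⟩ := hF
  -- Register q accumulates the sum, q + 1 is the counter, and the summand is computed from q + 2
  -- on.
  refine ⟨fun ℓ q => .seq (.setReg q (.lit 0)) (forLoop (q + 1) b
    (.seq (p (Function.update ℓ (Ctx.depth Γ) (q + 1)) (q + 2))
      (.setReg q (.add (.reg q) (.reg (q + 2)))))), C + 20, e + 1, fun ℓ q m γ s hs => ?_⟩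
  have hq := hs.le
  obtain ⟨s', t, hr, ht, hI⟩ := forLoop_runs (r := q + 1) (b := b)
    (p := .seq (p (Function.update ℓ (Ctx.depth Γ) (q + 1)) (q + 2))
      (.setReg q (.add (.reg q) (.reg (q + 2)))))
    (N := m.reg b) (T := C * weight m ^ e + 4)
    (fun j s' => SameBelow q s s' ∧ s'.reg (q + 1) = j ∧ s'.reg q = ∑ i ∈ range j, F m γ i)
    (fun j s' _ hs' => ⟨hs'.2.1, by rw [hs'.1.2 b (by omega), hs.agree.2 b hb]⟩)
    (by
      rintro j s₁ hj ⟨h1, h2, h3⟩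
      obtain ⟨s₂, t₂, hr₂, ht₂, hv₂, hb₂⟩ := h _ _ m (γ, j) s₁
        ((hs.sameBelow h1).push (r := q + 1) (Nat.le_succ q) h2)
      refine ⟨_, _, .seq hr₂ (.setReg _ _ _), ?_, ?_, ?_, ?_, ?_⟩
      · simp only [Expr.cost]
        omega
      · simp [hb₂.2 (q + 1) (by omega), h2]
      · exact (h1.trans (hb₂.mono (by omega))).trans
          ((SameBelow.update _ _ le_rfl _).trans (.update _ _ (Nat.le_succ q) _))
      · simp
      · simp [Expr.eval, hv₂, hb₂.2 q (by omega), h3, sum_range_succ])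
    (s := { s with reg := Function.update s.reg q 0 })
    ⟨(SameBelow.update _ _ le_rfl _).trans (.update _ _ (Nat.le_succ q) _), by simp, by simp⟩
  refine ⟨s', _, .seq (.setReg _ _ _) hr, ?_, hI.2.2, hI.1⟩
  have h1 := Nat.one_le_pow e _ (one_le_weight m)
  have h2 := (reg_lt_weight m hb).le
  have h3 := one_le_weight m
  calc _ ≤ 2 + (m.reg b * (C * weight m ^ e + 4 + 8) + 6) := by
        simp only [Expr.cost]; omega
    _ ≤ 2 + (weight m * (C * weight m ^ e + 4 + 8) + 6) := by gcongr
    _ ≤ _ := by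
        rw [pow_succ]
        nlinarith [Nat.mul_le_mul h1 h3]

lemma congr {f g : State → Γ → ℕ} (hf : Comp f) (h : ∀ m γ, f m γ = g m γ) : Comp g :=
  (funext₂ h : f = g) ▸ hf

/-- Multiplication is repeated addition, affordable because one factor is a global register and so
is bounded by the weight. -/
lemma regMul (b : ℕ) {f : State → Γ → ℕ} (hf : Comp f) (hb : b < 16 := by norm_num) :
    Comp fun m γ => m.reg b * f m γ :=
  (sum b (F := fun m γ _ => f m γ) hf.weaken hb).congr fun m γ => by simp

end Comp

namespace CompP

lemma congr {P Q : State → Γ → Prop} (hP : CompP P) (h : ∀ m γ, P m γ ↔ Q m γ) : CompP Q :=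
  (funext₂ fun m γ => propext (h m γ) : P = Q) ▸ hP

lemma ne_zero {f : State → Γ → ℕ} (hf : Comp f) : CompP fun m γ => f m γ ≠ 0 :=
  -- With truncated subtraction, 1 - (1 - x) is the indicator of x ≠ 0.
  ((Comp.const 1).sub ((Comp.const 1).sub hf)).congr fun m γ => by
    rcases Nat.eq_zero_or_pos (f m γ) with h | h
    · simp [h]
    · simp [h.ne']; omega

lemma not {P : State → Γ → Prop} (hP : CompP P) : CompP fun m γ => ¬ P m γ :=
  ((Comp.const 1).sub hP).congr fun m γ => by by_cases h : P m γ <;> simp [h]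

lemma and {P Q : State → Γ → Prop} (hP : CompP P) (hQ : CompP Q) :
    CompP fun m γ => P m γ ∧ Q m γ := by
  classical
  exact (Comp.ite hP hQ (.const 0)).congr fun m γ => by
    by_cases h : P m γ <;> by_cases h' : Q m γ <;> simp [h, h']

lemma or {P Q : State → Γ → Prop} (hP : CompP P) (hQ : CompP Q) :
    CompP fun m γ => P m γ ∨ Q m γ := by
  classical
  exact (Comp.ite hP (.const 1) hQ).congr fun m γ => by
    by_cases h : P m γ <;> by_cases h' : Q m γ <;> simp [h, h']

lemma imp {P Q : State → Γ → Prop} (hP : CompP P) (hQ : CompP Q) :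
    CompP fun m γ => P m γ → Q m γ := by
  classical
  exact (Comp.ite hP hQ (.const 1)).congr fun m γ => by
    by_cases h : P m γ <;> by_cases h' : Q m γ <;> simp [h, h']

lemma lt {f g : State → Γ → ℕ} (hf : Comp f) (hg : Comp g) : CompP fun m γ => f m γ < g m γ :=
  (ne_zero (hg.sub hf)).congr fun m γ => by omega

lemma le {f g : State → Γ → ℕ} (hf : Comp f) (hg : Comp g) : CompP fun m γ => f m γ ≤ g m γ :=
  (lt hg hf).not.congr fun m γ => by omega

lemma eq {f g : State → Γ → ℕ} (hf : Comp f) (hg : Comp g) : CompP fun m γ => f m γ = g m γ :=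
  ((le hf hg).and (le hg hf)).congr fun m γ => by omega

lemma exists_lt (b : ℕ) {P : State → Γ → ℕ → Prop}
    (hP : CompP fun m (γ : Γ × ℕ) => P m γ.1 γ.2) (hb : b < 16 := by norm_num) :
    CompP fun m γ => ∃ j < m.reg b, P m γ j := by
  classical
  exact
  (ne_zero (Comp.sum b (F := fun m γ j => if P m γ j then 1 else 0) hP hb)).congr fun m γ => by simp

lemma forall_lt (b : ℕ) {P : State → Γ → ℕ → Prop}
    (hP : CompP fun m (γ : Γ × ℕ) => P m γ.1 γ.2) (hb : b < 16 := by norm_num) :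
    CompP fun m γ => ∀ j < m.reg b, P m γ j :=
  (exists_lt b (P := fun m γ j => ¬ P m γ j) hP.not hb).not.congr fun m γ => by simp

end CompP

open Classical in
/-- The number of `j < N` that satisfy `P`. -/
noncomputable def count (N : ℕ) (P : ℕ → Prop) : ℕ := #{j ∈ range N | P j}

lemma Comp.count (b : ℕ) {P : State → Γ → ℕ → Prop}
    (hP : CompP fun m (γ : Γ × ℕ) => P m γ.1 γ.2) (hb : b < 16 := by norm_num) :
    Comp fun m γ => count (m.reg b) (P m γ) := by
  classical
  exact (Comp.sum b (F := fun m γ j => if P m γ j then 1 else 0) hP hb).congr fun m γ => by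
    simp [RAM.count]

end Comp

/-! ### Phases -/

/-- A single program turns, for each instance `i`, the memory `a i` into `b i`, and its running time
is polynomial in the weight of `b i`. Registers that are not global may be overwritten. -/
def Achieves {ι : Type} (a b : ι → State) : Prop :=
  (∀ i, weight (a i) ≤ weight (b i)) ∧
  ∃ (p : Program) (C e : ℕ), ∀ i s, Agree (a i) s →
    ∃ s' t, Runs p s s' t ∧ t ≤ C * weight (b i) ^ e ∧ Agree (b i) s'

lemma Achieves.refl {ι : Type} (a : ι → State) : Achieves a a :=
  ⟨fun _ => le_rfl, .skip, 1, 0, fun _ s hs => ⟨s, 1, .skip s, by simp, hs⟩⟩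

lemma Achieves.trans {ι : Type} {a b d : ι → State} (h : Achieves a b) (h' : Achieves b d) :
    Achieves a d := by
  obtain ⟨hw, p, C, e, h⟩ := h
  obtain ⟨hw', p', C', e', h'⟩ := h'
  refine ⟨fun i => (hw i).trans (hw' i), .seq p p', C + C', e + e', fun i s hs => ?_⟩
  obtain ⟨s₁, t₁, hr₁, ht₁, hs₁⟩ := h i s hs
  obtain ⟨s₂, t₂, hr₂, ht₂, hs₂⟩ := h' i s₁ hs₁
  refine ⟨s₂, _, .seq hr₁ hr₂, ?_, hs₂⟩
  rw [add_mul]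
  refine add_le_add (le_pow_weight (ht₁.trans ?_) le_rfl (Nat.le_add_right _ _))
    (le_pow_weight ht₂ le_rfl (Nat.le_add_left _ _))
  exact Nat.mul_le_mul_left _ (Nat.pow_le_pow_left (hw' i) _)

/-- Assign a value to a register. -/
def assign (r : ℕ) (f : State → ℕ) (m : State) : State :=
  { m with reg := Function.update m.reg r (f m) }

/-- Assigning only to a register that still holds 0 cannot decrease the weight. This is what lets
the time bounds of successive phases be stated in terms of the final memory. -/
lemma achieves_assign {ι : Type} {a : ι → State} (r : ℕ) {f : State → ℕ}
    (hf : Comp fun m (_ : Unit) => f m) (h0 : ∀ i, (a i).reg r = 0) :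
    Achieves a fun i => assign r f (a i) := by
  have hw : ∀ i, weight (a i) ≤ weight (assign r f (a i)) := by
    intro i
    refine Nat.add_le_add_left (sum_le_sum fun r' _ => ?_) _
    by_cases hr : r' = r
    · simp [hr, h0]
    · simp [assign, hr]
  obtain ⟨p, C, e, h⟩ := hf
  refine ⟨hw, .seq (p id 16) (.setReg r (.reg 16)), C + 2, e, fun i s hs => ?_⟩
  obtain ⟨s', t, hr, ht, hv, hb⟩ := h id 16 (a i) () s
    ⟨le_rfl, fun i hi => absurd hi (Nat.not_lt_zero i), hs,
      fun i hi => absurd hi (Nat.not_lt_zero i)⟩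
  refine ⟨_, _, .seq hr (.setReg _ _ _), ?_, hb.1.trans hs.1, fun i' hi => ?_⟩
  · have h1 := Nat.one_le_pow e _ (one_le_weight (assign r f (a i)))
    have h2 : t ≤ C * weight (assign r f (a i)) ^ e :=
      ht.trans (Nat.mul_le_mul_left _ (Nat.pow_le_pow_left (hw i) _))
    simp only [Expr.cost]
    nlinarith
  · have := (hs.sameBelow le_rfl hb).2 i' hi
    by_cases hir : i' = r
    · subst hir
      simp [assign, Expr.eval, hv]
    · simp [assign, hir, this]

lemma Achieves.assign {ι : Type} {a b : ι → State} (h : Achieves a b) (r : ℕ) (f : State → ℕ)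
    (hf : Comp fun m (_ : Unit) => f m) (h0 : ∀ i, (b i).reg r = 0) :
    Achieves a fun i => assign r f (b i) :=
  h.trans (achieves_assign r hf h0)

/-- Fill the first `N` entries of the array `a`; entry `j` may depend on the entries before. -/
def fillUpTo (a : ℕ) (F : State → ℕ → ℕ) (m : State) : ℕ → State
  | 0 => m
  | j + 1 =>
    { fillUpTo a F m j with
      arr := Function.update (fillUpTo a F m j).arr a
        (Function.update ((fillUpTo a F m j).arr a) j (F (fillUpTo a F m j) j)) }

section fill
variable (a : ℕ) (F : State → ℕ → ℕ) (m : State)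

@[simp] lemma fillUpTo_reg (N : ℕ) : (fillUpTo a F m N).reg = m.reg := by
  induction N with
  | zero => rfl
  | succ N ih => exact ih

lemma fillUpTo_arr_of_ne (N : ℕ) {a' : ℕ} (h : a' ≠ a) : (fillUpTo a F m N).arr a' = m.arr a' := by
  induction N with
  | zero => rfl
  | succ N ih => simp [fillUpTo, h, ih]

lemma fillUpTo_arr_of_le {N j : ℕ} (h : N ≤ j) : (fillUpTo a F m N).arr a j = m.arr a j := by
  induction N with
  | zero => rfl
  | succ N ih => simp [fillUpTo, (show j ≠ N by omega), ih (by omega)]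

lemma fillUpTo_arr_of_lt {N j : ℕ} (h : j < N) :
    (fillUpTo a F m N).arr a j = F (fillUpTo a F m j) j := by
  induction N with
  | zero => omega
  | succ N ih =>
    by_cases hj : j = N
    · simp [fillUpTo, hj]
    · simp [fillUpTo, hj, ih (by omega)]

/-- Fill the array `a`, up to the length given by register `b`. -/
def fill (a b : ℕ) (F : State → ℕ → ℕ) (m : State) : State := fillUpTo a F m (m.reg b)

@[simp] lemma fill_reg (b : ℕ) : (fill a b F m).reg = m.reg := fillUpTo_reg _ _ _ _

end fill

lemma weight_fill (a b : ℕ) (F : State → ℕ → ℕ) (m : State) :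
    weight (fill a b F m) = weight m := by
  simp [weight]

/-- Register 16, the first that is not global, is the counter. The weight depends on registers only,
so the bound for one entry stays the same while the array changes. -/
lemma achieves_fill {ι : Type} {d : ι → State} (a b : ℕ) {F : State → ℕ → ℕ}
    (hF : Comp fun m (γ : Unit × ℕ) => F m γ.2) (hb : b < 16 := by norm_num) :
    Achieves d fun i => fill a b F (d i) := by
  refine ⟨fun i => (weight_fill _ _ _ _).ge, ?_⟩
  simp only [weight_fill]
  obtain ⟨p, C, e, h⟩ := hF
  refine ⟨forLoop 16 b (.seq (p (fun _ => 16) 17) (.setArr a (.reg 16) (.reg 17))),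
    C + 17, e + 1, fun i s hs => ?_⟩
  generalize d i = m at hs ⊢
  have hw : ∀ j, weight (fillUpTo a F m j) = weight m := fun j => by simp [weight]
  obtain ⟨s', t, hr, ht, hI⟩ := forLoop_runs (r := 16) (b := b)
    (p := .seq (p (fun _ => 16) 17) (.setArr a (.reg 16) (.reg 17)))
    (N := m.reg b) (T := C * weight m ^ e + 3)
    (fun j s' => Agree (fillUpTo a F m j) s' ∧ s'.reg 16 = j)
    (fun j s' _ hs' => ⟨hs'.2, by rw [hs'.1.2 b hb]; simp⟩)
    (by
      rintro j s₁ hj ⟨h1, h2⟩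
      obtain ⟨s₂, t₂, hr₂, ht₂, hv₂, hb₂⟩ := h (fun _ => 16) 17 (fillUpTo a F m j) ((), j) s₁
        ⟨by norm_num, fun _ _ => by norm_num, h1, fun i hi => by
          have : i = 0 := Nat.lt_one_iff.1 hi
          subst this
          exact h2⟩
      rw [hw] at ht₂
      refine ⟨_, _, .seq hr₂ (.setArr _ _ _ _), ?_, ?_, ⟨?_, fun i hi => ?_⟩, ?_⟩
      · simp only [Expr.cost]
        omega
      · simp [hb₂.2 16 (by omega), h2]
      · simp [Expr.eval, hv₂, hb₂.2 16 (by omega), h2, fillUpTo, hb₂.1, h1.1]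
      · have := h1.2 i hi
        simp only [fillUpTo_reg] at this
        simp [(show i ≠ 16 by omega), hb₂.2 i (by omega), this]
      · simp)
    (s := s)
    ⟨⟨hs.1, fun i hi => by simpa [(show i ≠ 16 by omega), fillUpTo] using hs.2 i hi⟩, by simp⟩
  refine ⟨s', _, hr, ?_, hI.1⟩
  have h1 := Nat.one_le_pow e _ (one_le_weight m)
  have h2 := (reg_lt_weight m hb).le
  have h3 := one_le_weight m
  calc _ ≤ m.reg b * (C * weight m ^ e + 3 + 8) + 6 := ht
    _ ≤ weight m * (C * weight m ^ e + 3 + 8) + 6 := by gcongr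
    _ ≤ _ := by
        rw [pow_succ]
        nlinarith [Nat.mul_le_mul h1 h3]

end RAM

namespace MCS

/-! ### Covering within one colour class -/

section Cover

variable (n L B : ℕ) (U valid : ℕ → Prop) (hit cov : ℕ → ℕ → Prop)

/-- The vertices of `S` are valid, and each vertex of the class `U` is in `S` or is content with one
of the items that are hit by `S`. -/
def Feasible (S : ℕ → Prop) : Prop :=
  ∀ v < n, U v → (S v → valid v) ∧ (S v ∨ ∃ j < L, cov v j ∧ ∃ s < n, S s ∧ hit s j)

/-- The vertex `v` can be used to hit all items of the block `b` of `g`. -/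
def IsRep (g : ℕ → ℕ) (b v : ℕ) : Prop :=
  U v ∧ valid v ∧ ∀ j < L, g j = b → hit v j

/-- The set of vertices described by `g`. Items with value `0` are those that are not hit. Vertices
that are not content with the other items belong to the set; moreover, each nonempty block `b ≥ 2`
contributes one vertex that hits the items of this block. -/
def Cand (g : ℕ → ℕ) (v : ℕ) : Prop :=
  U v ∧ ((∀ j < L, g j ≠ 0 → ¬ cov v j) ∨
    ∃ b < B, 2 ≤ b ∧ (∃ j < L, g j = b) ∧ IsRep L U valid hit g b v ∧
      ∀ u < n, u < v → ¬ IsRep L U valid hit g b u)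

variable {n L B U valid hit cov}

lemma IsRep.congr {g g' : ℕ → ℕ} (h : ∀ j < L, g j = g' j) {b v : ℕ}
    (hv : IsRep L U valid hit g b v) : IsRep L U valid hit g' b v :=
  ⟨hv.1, hv.2.1, fun j hj hb => hv.2.2 j hj ((h j hj).trans hb)⟩

lemma Cand.congr {g g' : ℕ → ℕ} (h : ∀ j < L, g j = g' j) {v : ℕ}
    (hv : Cand n L B U valid hit cov g v) : Cand n L B U valid hit cov g' v := by
  refine ⟨hv.1, hv.2.imp (fun h' j hj hj' => h' j hj (by rwa [h j hj])) ?_⟩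
  rintro ⟨b, hb, hb2, ⟨j, hj, hjb⟩, hr, hu⟩
  exact ⟨b, hb, hb2, ⟨j, hj, (h j hj).symm.trans hjb⟩, hr.congr h,
    fun u hu' huv hr' => hu u hu' huv (hr'.congr fun j hj => (h j hj).symm)⟩

lemma cand_congr {g g' : ℕ → ℕ} (h : ∀ j < L, g j = g' j) :
    Cand n L B U valid hit cov g = Cand n L B U valid hit cov g' :=
  funext fun _ => propext ⟨.congr h, .congr fun j hj => (h j hj).symm⟩

open Classical in
-- An exchange argument: keep the forced vertices of `S`, and replace the vertices that hit the
-- other items by the least representatives of their blocks. Exactly the items hit by `S` get a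
-- nonzero value, at least among those below `L`.
theorem exists_cand_le {S : ℕ → Prop} (hS : ∀ v, S v → v < n ∧ U v) (hB : L + 2 ≤ B)
    (hf : Feasible n L U valid hit cov S) :
    ∃ g : ℕ → ℕ, (∀ j, g j < B) ∧
      Feasible n L U valid hit cov (Cand n L B U valid hit cov g) ∧
      #{v ∈ range n | Cand n L B U valid hit cov g v} ≤ #{v ∈ range n | S v} := by
  set P : ℕ → Prop := fun j => ∃ s, S s ∧ hit s j with hP
  -- The forced vertices: none of the items hit by `S` makes them content.
  set F : ℕ → Prop := fun v => v < n ∧ U v ∧ ∀ j < L, P j → ¬ cov v j with hF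
  have hFS : ∀ v, F v → S v := by
    rintro v ⟨hv, hU, hc⟩
    refine (hf v hv hU).2.resolve_right ?_
    rintro ⟨j, hj, hcov, s, -, hs, hh⟩
    exact hc j hj ⟨s, hs, hh⟩ hcov
  set Q : ℕ → Prop := fun j => j < L ∧ P j ∧ ¬ ∃ s, F s ∧ hit s j with hQ
  have hex : ∀ j, ∃ s, P j → S s ∧ hit s j := fun j => by
    by_cases h : P j
    · obtain ⟨s, hs⟩ := h
      exact ⟨s, fun _ => hs⟩
    · exact ⟨0, fun h' => absurd h' h⟩
  choose e he using hex
  -- Blocks are the fibres of `e` on `Q`, labelled by their least item. Adding 2 keeps the labels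
  -- apart from the values 0 and 1, and `L + 2 ≤ B` leaves room for them.
  set r : ℕ → ℕ := fun j => sInf {j' | Q j' ∧ e j' = e j} with hr
  have hrQ : ∀ j, Q j → Q (r j) ∧ e (r j) = e j := fun j hj =>
    Nat.sInf_mem (s := {j' | Q j' ∧ e j' = e j}) ⟨j, hj, rfl⟩
  have hre : ∀ {j j'}, e j = e j' → r j = r j' := fun {j j'} h => by simp only [hr, h]
  set g : ℕ → ℕ := fun j => if Q j then r j + 2 else if P j then 1 else 0 with hg
  have hgQ : ∀ {j b}, 2 ≤ b → g j = b → Q j ∧ b = r j + 2 := by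
    intro j b hb hj
    simp only [hg] at hj
    split_ifs at hj with h1 h2
    · exact ⟨h1, hj.symm⟩
    all_goals omega
  have hgP : ∀ j, P j → g j ≠ 0 := by
    intro j hj
    simp only [hg]
    split_ifs <;> simp
  have hrep : ∀ j, Q j → IsRep L U valid hit g (r j + 2) (e j) := by
    intro j hj
    have hs := (he j hj.2.1).1
    refine ⟨(hS _ hs).2, (hf _ (hS _ hs).1 (hS _ hs).2).1 hs, fun j' hj' hb => ?_⟩
    obtain ⟨hQ', hr'⟩ := hgQ (by omega) hb
    have : e j' = e j := by
      rw [← (hrQ j hj).2, ← (hrQ j' hQ').2]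
      congr 1
      omega
    exact this ▸ (he j' hQ'.2.1).2
  set ρ : ℕ → ℕ := fun b => sInf {v | IsRep L U valid hit g b v} with hρ
  have hρrep : ∀ j, Q j → IsRep L U valid hit g (r j + 2) (ρ (r j + 2)) := fun j hj =>
    Nat.sInf_mem (s := {v | IsRep L U valid hit g (r j + 2) v}) ⟨_, hrep j hj⟩
  have hρn : ∀ j, Q j → ρ (r j + 2) < n := fun j hj =>
    (Nat.sInf_le (s := {v | IsRep L U valid hit g (r j + 2) v}) (hrep j hj)).trans_lt
      (hS _ (he j hj.2.1).1).1
  have hrB : ∀ j, Q j → r j + 2 < B := fun j hj => by have := (hrQ j hj).1.1; omega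
  have hgj : ∀ j, Q j → g j = r j + 2 := fun j hj => if_pos hj
  have hcF : ∀ v, F v → Cand n L B U valid hit cov g v := by
    rintro v ⟨hv, hU, hc⟩
    refine ⟨hU, .inl fun j hj hgj => hc j hj ?_⟩
    by_contra hPj
    exact hgj (by simp [hg, hQ, hPj])
  have hcρ : ∀ j, Q j → Cand n L B U valid hit cov g (ρ (r j + 2)) := fun j hj =>
    ⟨(hρrep j hj).1, .inr ⟨_, hrB j hj, by omega, ⟨j, hj.1, hgj j hj⟩, hρrep j hj,
      fun u _ hu => Nat.notMem_of_lt_sInf hu⟩⟩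
  have hc : ∀ v < n, Cand n L B U valid hit cov g v → F v ∨ ∃ j, Q j ∧ v = ρ (r j + 2) := by
    rintro v hv ⟨hU, h | ⟨b, -, hb2, ⟨j, hj, hjb⟩, hrv, hu⟩⟩
    · exact .inl ⟨hv, hU, fun j hj hPj => h j hj (hgP j hPj)⟩
    · obtain ⟨hQj, rfl⟩ := hgQ hb2 hjb
      refine .inr ⟨j, hQj, le_antisymm ?_ (Nat.sInf_le hrv)⟩
      by_contra! hlt
      exact hu _ (hρn j hQj) hlt (hρrep j hQj)
  refine ⟨g, fun j => ?_, fun v hv hU => ⟨fun h => ?_, ?_⟩, ?_⟩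
  · by_cases hj : Q j
    · rw [hgj j hj]
      exact hrB j hj
    · simp only [hg, if_neg hj]
      split_ifs <;> omega
  · rcases hc v hv h with h | ⟨j, hj, rfl⟩
    · exact (hf v hv hU).1 (hFS v h)
    · exact (hρrep j hj).2.1
  · by_cases hFv : F v
    · exact .inl (hcF v hFv)
    · have : ∃ j < L, P j ∧ cov v j := by
        by_contra! h
        exact hFv ⟨hv, hU, h⟩
      obtain ⟨j, hj, hPj, hcj⟩ := this
      refine .inr ⟨j, hj, hcj, ?_⟩
      by_cases hFj : ∃ s, F s ∧ hit s j
      · obtain ⟨s, hs, hh⟩ := hFj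
        exact ⟨s, hs.1, hcF s hs, hh⟩
      · have hQj : Q j := ⟨hj, hPj, hFj⟩
        exact ⟨_, hρn j hQj, hcρ j hQj, (hρrep j hQj).2.2 j hj (hgj j hQj)⟩
  -- `J` is the set of block labels. It injects into `S` minus `F` through `e`: a label lies in its
  -- own block, so its image under `e` determines it, and no item of `Q` is hit by a forced vertex.
  · set J := {j ∈ range L | Q j}.image r with hJ
    have h1 : #J ≤ #{v ∈ range n | S v ∧ ¬ F v} := by
      refine card_le_card_of_injOn e ?_ ?_
      · intro x hx
        simp only [hJ, coe_image, Set.mem_image, mem_coe, mem_filter] at hx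
        obtain ⟨j, ⟨-, hj⟩, rfl⟩ := hx
        have hs := he j hj.2.1
        simp only [(hrQ j hj).2, coe_filter, Set.mem_ofPred_eq, mem_range]
        exact ⟨(hS _ hs.1).1, hs.1, fun hFe => hj.2.2 ⟨_, hFe, hs.2⟩⟩
      · intro x hx y hy hxy
        simp only [hJ, coe_image, Set.mem_image, mem_coe, mem_filter] at hx hy
        obtain ⟨j, ⟨-, hj⟩, rfl⟩ := hx
        obtain ⟨j', ⟨-, hj'⟩, rfl⟩ := hy
        rw [(hrQ j hj).2, (hrQ j' hj').2] at hxy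
        exact hre hxy
    have h2 : {v ∈ range n | Cand n L B U valid hit cov g v} ⊆
        {v ∈ range n | S v ∧ F v} ∪ J.image fun j => ρ (j + 2) := by
      intro v hv
      simp only [mem_filter, mem_range] at hv
      rcases hc v hv.1 hv.2 with h | ⟨j, hj, rfl⟩
      · simp [hv.1, h, hFS v h]
      · refine mem_union_right _ (mem_image_of_mem (fun j => ρ (j + 2)) (mem_image_of_mem r ?_))
        simp [hj, hj.1]
    refine (card_le_card h2).trans ?_
    calc _ ≤ #{v ∈ range n | S v ∧ F v} + #(J.image fun j => ρ (j + 2)) :=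
        card_union_le _ _
      _ ≤ #{v ∈ range n | S v ∧ F v} + #{v ∈ range n | S v ∧ ¬ F v} :=
        Nat.add_le_add_left (card_image_le.trans h1) _
      _ = _ := by
        rw [← filter_filter S F, ← filter_filter S fun v => ¬ F v, card_filter_add_card_filter_not]

end Cover

/-! ### Distances and vertex covers -/

section Distance

variable {V C : Type*} {G : SimpleGraph V}

/-- On a shortest path, the edges from position 2j to 2j + 1 are pairwise disjoint, and the cover
contains an endpoint of each. -/
lemma edist_le_two_mul_card {X : Finset V} (hX : G.IsVertexCover (X : Set V))
    {u v : V} (h : G.edist u v ≠ ⊤) : G.edist u v ≤ (2 * #X : ℕ) := by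
  have hreach := SimpleGraph.edist_ne_top_iff_reachable.1 h
  obtain ⟨p, hp, hlen⟩ := hreach.exists_path_of_dist
  rw [← hreach.coe_dist_eq_edist, ← hlen]
  classical
  set f : ℕ → V := fun j => if p.getVert (2 * j) ∈ X then p.getVert (2 * j) else
    p.getVert (2 * j + 1) with hf
  have hinj := hp.getVert_injOn
  have hfj : ∀ j, ∃ i, f j = p.getVert i ∧ 2 * j ≤ i ∧ i ≤ 2 * j + 1 := by
    intro j
    simp only [hf]
    split_ifs
    · exact ⟨_, rfl, by omega, by omega⟩
    · exact ⟨_, rfl, by omega, by omega⟩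
  have key : #(range ((p.length + 1) / 2)) ≤ #X := by
    refine card_le_card_of_injOn f ?_ ?_
    · intro j hj
      have hj : j < (p.length + 1) / 2 := by simpa using hj
      have hadj := p.adj_getVert_succ (i := 2 * j) (by omega)
      simp only [hf]
      split_ifs with h1
      · exact h1
      · exact (hX hadj).resolve_left h1
    · intro j hj j' hj' hjj'
      have hj : j < (p.length + 1) / 2 := by simpa using hj
      have hj' : j' < (p.length + 1) / 2 := by simpa using hj'
      obtain ⟨i, hi, hi1, hi2⟩ := hfj j
      obtain ⟨i', hi', hi1', hi2'⟩ := hfj j'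
      rw [hi, hi'] at hjj'
      have := hinj (show i ∈ {i | i ≤ p.length} from (by omega : i ≤ p.length))
        (show i' ∈ {i | i ≤ p.length} from (by omega : i' ≤ p.length)) hjj'
      omega
  rw [card_range] at key
  exact_mod_cast (by omega : p.length ≤ 2 * #X)

lemma edist_adj_le {u v y : V} (h : G.Adj v y) : G.edist v u ≤ G.edist y u + 1 := by
  have := G.edist_triangle (u := v) (v := y) (w := u)
  rwa [SimpleGraph.edist_eq_one_iff_adj.2 h, add_comm] at this

lemma exists_adj_edist {u v : V} {k : ℕ} (h : G.edist v u = k) (hne : v ≠ u) :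
    ∃ y, G.Adj v y ∧ G.edist v u = G.edist y u + 1 := by
  obtain ⟨p, hp⟩ := SimpleGraph.exists_walk_of_edist_eq_coe h
  cases p with
  | nil => exact absurd rfl hne
  | cons hadj q =>
    rename_i y
    refine ⟨y, hadj, le_antisymm (edist_adj_le hadj) ?_⟩
    rw [h, ← hp, SimpleGraph.Walk.length_cons, Nat.cast_add, Nat.cast_one]
    gcongr
    exact G.edist_le q

lemma edist_le_succ_iff {u v : V} {t : ℕ} :
    G.edist u v ≤ (t + 1 : ℕ) ↔ ∃ w, G.edist u w ≤ t ∧ (w = v ∨ G.Adj w v) := by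
  constructor
  · intro h
    by_cases hne : v = u
    · exact ⟨v, by simp [hne], .inl rfl⟩
    · rw [SimpleGraph.edist_comm] at h
      obtain ⟨k, hk⟩ := ENat.ne_top_iff_exists.1 (h.trans_lt (ENat.natCast_lt_top _)).ne
      obtain ⟨y, hy, hy'⟩ := exists_adj_edist hk.symm hne
      refine ⟨y, ?_, .inr hy.symm⟩
      rw [hy', Nat.cast_add, Nat.cast_one] at h
      rw [SimpleGraph.edist_comm]
      exact (ENat.add_le_add_iff_right (by simp)).1 h
  · rintro ⟨w, hw, rfl | hadj⟩
    · exact hw.trans (by exact_mod_cast Nat.le_succ t)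
    · rw [SimpleGraph.edist_comm] at hw ⊢
      refine (edist_adj_le hadj.symm).trans ?_
      rw [Nat.cast_add, Nat.cast_one]
      gcongr

/-- The natural numbers `D u v` are the distances, with `M` in place of `⊤`. -/
structure IsCapped (G : SimpleGraph V) (M : ℕ) (D : V → V → ℕ) : Prop where
  eq_min : ∀ u v, (D u v : ℕ∞) = min (G.edist u v) M
  lt : ∀ u v, G.edist u v ≠ ⊤ → G.edist u v < M

open Classical in
lemma isCapped_of_card {M : ℕ} {D : V → V → ℕ}
    (hM : ∀ u v, G.edist u v ≠ ⊤ → G.edist u v < M)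
    (hD : ∀ u v, D u v = #{t ∈ range M | ¬ G.edist u v ≤ (t : ℕ)}) : IsCapped G M D := by
  refine ⟨fun u v => ?_, hM⟩
  rw [hD]
  by_cases h : G.edist u v = ⊤
  · simp [h]
  · have hlt := hM u v h
    obtain ⟨k, hk⟩ := ENat.ne_top_iff_exists.1 h
    rw [min_eq_left hlt.le, ← hk]
    rw [← hk] at hlt
    have hlt : k < M := by exact_mod_cast hlt
    have : {t ∈ range M | ¬ (k : ℕ∞) ≤ (t : ℕ)} = range k := by
      ext t
      simp only [mem_filter, mem_range, Nat.cast_le]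
      omega
    rw [this, card_range]

namespace IsCapped

variable {M : ℕ} {D : V → V → ℕ} (hD : IsCapped G M D)
include hD

lemma cases (u v : V) : (G.edist u v = ⊤ ∧ D u v = M) ∨ (G.edist u v = D u v ∧ D u v < M) := by
  have h := hD.eq_min u v
  by_cases ht : G.edist u v = ⊤
  · rw [ht, min_eq_right le_top] at h
    exact .inl ⟨ht, by exact_mod_cast h⟩
  · have hlt := hD.lt u v ht
    rw [min_eq_left hlt.le] at h
    exact .inr ⟨h.symm, by rw [← h] at hlt; exact_mod_cast hlt⟩

lemma le (u v : V) : D u v ≤ M := by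
  rcases hD.cases u v with h | h <;> omega

lemma le_iff {u v u' v' : V} : D u v ≤ D u' v' ↔ G.edist u v ≤ G.edist u' v' := by
  have h1 := hD.le u v
  rcases hD.cases u v with ⟨h, hd⟩ | ⟨h, hd⟩ <;> rcases hD.cases u' v' with ⟨h', hd'⟩ | ⟨h', hd'⟩
  · simp [h, h', hd, hd']
  · simp [h, h', hd, hd']
  · simp [h', hd', h1]
  · simp [h, h']

lemma adj_le {u v y : V} (h : G.Adj v y) : D v u ≤ D y u + 1 := by
  have hle := edist_adj_le (u := u) h
  have h1 := hD.le v u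
  rcases hD.cases y u with ⟨h', hd'⟩ | ⟨h', hd'⟩
  · omega
  · rcases hD.cases v u with ⟨h'', hd''⟩ | ⟨h'', hd''⟩
    · rw [h', h''] at hle
      exact absurd (top_le_iff.1 hle) (ENat.natCast_ne_top (D y u + 1))
    · rw [h', h''] at hle
      exact_mod_cast hle

lemma exists_adj {u v : V} (hne : v ≠ u) : D v u = M ∨ ∃ y, G.Adj v y ∧ D v u = D y u + 1 := by
  rcases hD.cases v u with ⟨h', hd'⟩ | ⟨h', hd'⟩
  · exact .inl hd'
  · obtain ⟨y, hy, hy'⟩ := exists_adj_edist h' hne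
    refine .inr ⟨y, hy, ?_⟩
    rcases hD.cases y u with ⟨h'', hd''⟩ | ⟨h'', hd''⟩
    · rw [h', h''] at hy'
      exact absurd hy' (ENat.natCast_ne_top _)
    · rw [h', h''] at hy'
      exact_mod_cast hy'

lemma adj_eq {u v y : V} (h : D v u = M) (hadj : G.Adj v y) : D y u = M := by
  rcases hD.cases v u with ⟨h', -⟩ | ⟨-, hd'⟩
  · rcases hD.cases y u with ⟨-, hd''⟩ | ⟨h'', -⟩
    · exact hd''
    · have hle := edist_adj_le (u := u) hadj
      rw [h', h''] at hle
      exact absurd (top_le_iff.1 hle) (ENat.natCast_ne_top (D y u + 1))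
  · omega

lemma self_le (v u : V) (s : V) : D v v ≤ D u s := by
  rw [hD.le_iff]
  simp

lemma isConsistent_iff {χ : V → C} {S : Set V} :
    IsConsistent G χ S ↔ ∀ v, ∃ s ∈ S, χ s = χ v ∧ ∀ u ∈ S, D v s ≤ D v u := by
  refine forall_congr' fun v => exists_congr fun s => ?_
  simp only [nearest, distTo, Set.mem_ofPred_eq, hD.le_iff]
  constructor
  · rintro ⟨⟨hs, he⟩, hχ⟩
    exact ⟨hs, hχ, fun u hu => he ▸ iInf₂_le u hu⟩
  · rintro ⟨hs, hχ, hu⟩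
    exact ⟨⟨hs, le_antisymm (le_iInf₂ hu) (iInf₂_le s hs)⟩, hχ⟩

end IsCapped

/-- The vertices of the vertex cover `X` through which the vertex `v` sees the set: `v` itself if it
is in `X`, and the neighbours of `v` in `X` otherwise. -/
def Sees (G : SimpleGraph V) (X : Set V) (v x : V) : Prop :=
  x ∈ X ∧ ((v ∈ X ∧ v = x) ∨ (v ∉ X ∧ G.Adj v x))

/-- The set `S` contains `v`, or, for distances `d x` from the vertices `x` of the cover `X` to a
superset of `S`, a nearest neighbour of `v` with the same colour as `v`. -/
def Content (G : SimpleGraph V) (χ : V → C) (X : Set V) (D : V → V → ℕ) (d : V → ℕ) (S : Set V)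
    (v : V) : Prop :=
  v ∈ S ∨ ((∀ x, ¬ Sees G X v x) ∧ ∃ s ∈ S, χ s = χ v) ∨
    ∃ x, Sees G X v x ∧ (∀ y, Sees G X v y → d x ≤ d y) ∧ ∃ s ∈ S, χ s = χ v ∧ D x s = d x

variable {M : ℕ} {D : V → V → ℕ} {X S : Set V} {χ : V → C}

lemma sees_iff_adj (hX : G.IsVertexCover X) {v x : V} (hv : v ∉ X) :
    Sees G X v x ↔ G.Adj v x := by
  refine ⟨fun h => ?_, fun h => ⟨(hX h).resolve_left hv, .inr ⟨hv, h⟩⟩⟩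
  obtain ⟨-, h | h⟩ := h
  · exact absurd h.1 hv
  · exact h.2

lemma sees_iff_eq {v x : V} (hv : v ∈ X) : Sees G X v x ↔ v = x := by
  constructor
  · rintro ⟨-, h | h⟩
    · exact h.2
    · exact absurd hv h.1
  · rintro rfl
    exact ⟨hv, .inl ⟨hv, rfl⟩⟩

/-- For v outside `X` and `S`, content through x with witness s, and for u ∈ `S` at uncapped
distance, let y be the first step from v towards u. Then D v s ≤ D x s + 1 = d x + 1 ≤ d y + 1 ≤ D y
u + 1 = D v u. -/
theorem isConsistent_of_content (hX : G.IsVertexCover X) (hD : IsCapped G M D) {d : V → ℕ}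
    (hd : ∀ s ∈ S, ∀ x ∈ X, d x ≤ D x s) (hc : ∀ v, Content G χ X D d S v) :
    IsConsistent G χ S := by
  rw [hD.isConsistent_iff]
  intro v
  by_cases hvS : v ∈ S
  · exact ⟨v, hvS, rfl, fun u _ => hD.self_le v v u⟩
  by_cases hv : v ∈ X
  · obtain h | ⟨h, -⟩ | ⟨x, hx, -, s, hs, hχ, hxs⟩ := hc v
    · exact absurd h hvS
    · exact absurd ((sees_iff_eq hv).2 rfl) (h v)
    · obtain rfl := (sees_iff_eq hv).1 hx
      exact ⟨s, hs, hχ, fun u hu => hxs ▸ hd u hu v hv⟩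
  · obtain h | ⟨h, s, hs, hχ⟩ | ⟨x, hx, hmin, s, hs, hχ, hxs⟩ := hc v
    · exact absurd h hvS
    · refine ⟨s, hs, hχ, fun u hu => ?_⟩
      rcases hD.exists_adj (v := v) (u := u) (by rintro rfl; exact hvS hu) with h' | ⟨y, hy, -⟩
      · rw [h']
        exact hD.le v s
      · exact absurd ((sees_iff_adj hX hv).2 hy) (h y)
    · refine ⟨s, hs, hχ, fun u hu => ?_⟩
      rcases hD.exists_adj (v := v) (u := u) (by rintro rfl; exact hvS hu) with h' | ⟨y, hy, hy'⟩
      · rw [h']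
        exact hD.le v s
      · have h1 := hD.adj_le (u := s) ((sees_iff_adj hX hv).1 hx)
        have h2 := hmin y ((sees_iff_adj hX hv).2 hy)
        have h3 := hd u hu y ((sees_iff_adj hX hv).2 hy).1
        omega

theorem exists_content_of_isConsistent (hX : G.IsVertexCover X) (hD : IsCapped G M D)
    (hS : IsConsistent G χ S) : ∃ d : V → ℕ, (∀ x, d x ≤ M) ∧
      (∀ s ∈ S, ∀ x ∈ X, d x ≤ D x s) ∧ ∀ v, Content G χ X D d S v := by
  rw [hD.isConsistent_iff] at hS
  choose f hfS hfχ hf using hS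
  refine ⟨fun x => D x (f x), fun x => hD.le _ _, fun s hs x _ => hf x s hs, fun v => ?_⟩
  by_cases hvS : v ∈ S
  · exact .inl hvS
  by_cases hv : v ∈ X
  · exact .inr (.inr ⟨v, (sees_iff_eq hv).2 rfl, fun y hy => by
      rw [(sees_iff_eq hv).1 hy], f v, hfS v, hfχ v, rfl⟩)
  · have hne : v ≠ f v := fun h => hvS (h ▸ hfS v)
    by_cases hiso : ∃ y, G.Adj v y
    · obtain ⟨y₀, hy₀⟩ := hiso
      -- If v cannot reach `S`, neither can its neighbours; all their values are `M`, and any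
      -- neighbour serves. Otherwise take the first step y towards `f v`, which is then nearest to y
      -- as well.
      rcases hD.exists_adj hne with htop | ⟨y, hy, hy'⟩
      · have hall : ∀ u ∈ S, ∀ y, G.Adj v y → D y u = M := fun u hu y hy =>
          hD.adj_eq (le_antisymm (hD.le _ _) (htop ▸ hf v u hu)) hy
        refine .inr (.inr ⟨y₀, (sees_iff_adj hX hv).2 hy₀, fun y hy => ?_, f v, hfS v, hfχ v, ?_⟩)
        · dsimp only
          rw [hall _ (hfS _) y ((sees_iff_adj hX hv).1 hy)]
          exact hD.le _ _
        · dsimp only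
          rw [hall _ (hfS _) _ hy₀, hall _ (hfS _) _ hy₀]
      · have hmin : ∀ y', G.Adj v y' → ∀ u ∈ S, D y (f v) ≤ D y' u := by
          intro y' hadj u hu
          have h1 := hf v u hu
          have h2 := hD.adj_le (u := u) hadj
          omega
        have heq : D y (f v) = D y (f y) := le_antisymm (hmin y hy _ (hfS y)) (hf y _ (hfS v))
        refine .inr (.inr ⟨y, (sees_iff_adj hX hv).2 hy, fun y' hy' => ?_, f v, hfS v, hfχ v, heq⟩)
        dsimp only
        rw [← heq]
        exact hmin y' ((sees_iff_adj hX hv).1 hy') _ (hfS y')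
    · exact .inr (.inl ⟨fun x hx => hiso ⟨x, (sees_iff_adj hX hv).1 hx⟩, f v, hfS v, hfχ v⟩)

end Distance

open RAM

/-! ### The functions computed by the algorithm

Registers: `0` number `n` of vertices, `1` number of colours, `2` the value `n * n`, `3` size `K` of
the vertex cover, `4` cap `M = 2 * K + 1` for distances, `5` base `B = 2 * K + 4`, `6` number
`L = K + 1` of items, `7` the value `K + 2`, `8` the value `M * n * n`, `9` the number `B ^ L` of
codes, `10` the value `n + 1`.

Arrays: `0` colours, `1` adjacency matrix, `2` output, `3` maximal matching, `4` vertex cover,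
`5` reachability by walks of bounded length, `6` powers of the base. -/

def Adjacent (m : State) (u v : ℕ) : Prop := m.arr 1 (m.reg 0 * u + v) ≠ 0

def Matched (m : State) (u v : ℕ) : Prop := m.arr 3 (m.reg 0 * u + v) ≠ 0

open Classical in
/-- Greedy choice of a matching. -/
noncomputable def matchStep (m : State) (e : ℕ) : ℕ :=
  if ∃ u < m.reg 0, ∃ v < m.reg 0, e = m.reg 0 * u + v ∧ Adjacent m u v ∧
    ¬ ∃ a < m.reg 0, ∃ b < m.reg 0, Matched m a b ∧ ((a = u ∨ a = v) ∨ (b = u ∨ b = v))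
  then 1 else 0

open Classical in
noncomputable def coverStep (m : State) (v : ℕ) : ℕ :=
  if ∃ a < m.reg 0, ∃ b < m.reg 0, Matched m a b ∧ (a = v ∨ b = v) then 1 else 0

def InCover (m : State) (v : ℕ) : Prop := m.arr 4 v ≠ 0

noncomputable def rank (m : State) (x : ℕ) : ℕ := count (m.reg 0) fun y => y < x ∧ InCover m y

def Reached (m : State) (t u v : ℕ) : Prop := m.arr 5 (m.reg 2 * t + (m.reg 0 * u + v)) ≠ 0

open Classical in
noncomputable def reachStep (m : State) (e : ℕ) : ℕ :=
  if ∃ t < m.reg 4, ∃ u < m.reg 0, ∃ v < m.reg 0, e = m.reg 2 * t + (m.reg 0 * u + v) ∧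
    ((t = 0 ∧ u = v) ∨
      (t ≠ 0 ∧ ∃ w < m.reg 0, Reached m (t - 1) u w ∧ (w = v ∨ Adjacent m w v)))
  then 1 else 0

/-- The capped distance. -/
noncomputable def capDist (m : State) (u v : ℕ) : ℕ := count (m.reg 4) fun t => ¬ Reached m t u v

def powStep (m : State) (j : ℕ) : ℕ := if j = 0 then 1 else m.reg 5 * m.arr 6 (j - 1)

/-- The quotient of `N` by the `j`-th power of the base. -/
noncomputable def quot (m : State) (N j : ℕ) : ℕ :=
  count (m.reg 9) fun t => (∑ i ∈ range (m.reg 9), if i ≤ t then m.arr 6 j else 0) ≤ N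

/-- The `j`-th digit of `N`. -/
noncomputable def digit (m : State) (N j : ℕ) : ℕ := quot m N j - m.reg 5 * quot m N (j + 1)

/-- The distance from `x` to the solution, according to the code `z`. -/
noncomputable def codeDist (m : State) (z x : ℕ) : ℕ := digit m z (rank m x)

/-- The guessed distances are required only as lower bounds, a condition on each selected vertex
alone; this decouples the colours. -/
def Valid (m : State) (z s : ℕ) : Prop :=
  ∀ x < m.reg 0, InCover m x → codeDist m z x ≤ capDist m x s

/-- Item j < K is the cover vertex of rank j. Item K is hit by every vertex, so it is hit as soon as
the colour occurs. -/
def Hits (m : State) (z s j : ℕ) : Prop :=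
  j = m.reg 3 ∨ ∃ x < m.reg 0, InCover m x ∧ rank m x = j ∧ capDist m x s = codeDist m z x

def SeesCover (m : State) (v x : ℕ) : Prop :=
  InCover m x ∧ ((InCover m v ∧ v = x) ∨ (¬ InCover m v ∧ Adjacent m v x))

/-- Item K serves the isolated vertices outside the cover, for which all elements of the solution
are equally far away. -/
def ContentWith (m : State) (z v j : ℕ) : Prop :=
  (j = m.reg 3 ∧ ∀ x < m.reg 0, ¬ SeesCover m v x) ∨
    ∃ x < m.reg 0, rank m x = j ∧ SeesCover m v x ∧
      ∀ y < m.reg 0, SeesCover m v y → codeDist m z x ≤ codeDist m z y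

/-- The vertices of colour `i` that belong to the solution with codes `z` and `g`. -/
def Selected (m : State) (z i g v : ℕ) : Prop :=
  Cand (m.reg 0) (m.reg 6) (m.reg 5) (fun v => m.arr 0 v = i) (Valid m z) (Hits m z)
    (ContentWith m z) (digit m g) v

def Admissible (m : State) (z i g : ℕ) : Prop :=
  Feasible (m.reg 0) (m.reg 6) (fun v => m.arr 0 v = i) (Valid m z) (Hits m z) (ContentWith m z)
    (Selected m z i g)

noncomputable def selectedCard (m : State) (z i g : ℕ) : ℕ := count (m.reg 0) (Selected m z i g)

/-- The least size of an admissible selection of colour `i`. -/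
noncomputable def colorCost (m : State) (z i : ℕ) : ℕ :=
  count (m.reg 10) fun t => ¬ ∃ g < m.reg 9, Admissible m z i g ∧ selectedCard m z i g ≤ t

noncomputable def totalCost (m : State) (z : ℕ) : ℕ := ∑ i ∈ range (m.reg 1), colorCost m z i

/-- The least `t < N` that satisfies `P`. -/
noncomputable def least (N : ℕ) (P : ℕ → Prop) : ℕ := count N fun t => ∀ t' < N, t' ≤ t → ¬ P t'

noncomputable def bestDist (m : State) : ℕ :=
  least (m.reg 9) fun t => ∀ z < m.reg 9, totalCost m t ≤ totalCost m z

noncomputable def bestCode (m : State) (i : ℕ) : ℕ :=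
  least (m.reg 9) fun g => Admissible m (bestDist m) i g ∧
    selectedCard m (bestDist m) i g ≤ colorCost m (bestDist m) i

open Classical in
noncomputable def outStep (m : State) (v : ℕ) : ℕ :=
  if Selected m (bestDist m) (m.arr 0 v) (bestCode m (m.arr 0 v)) v then 1 else 0

/-! ### Polynomial-time evaluation of the search functions -/

section Comp

variable {Γ : Type} [Ctx Γ] {f g h k : State → Γ → ℕ}

lemma compP_adjacent (hf : Comp f) (hg : Comp g) :
    CompP fun m γ => Adjacent m (f m γ) (g m γ) :=
  .ne_zero (.arr 1 ((hf.regMul 0).add hg))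

lemma compP_matched (hf : Comp f) (hg : Comp g) :
    CompP fun m γ => Matched m (f m γ) (g m γ) :=
  .ne_zero (.arr 3 ((hf.regMul 0).add hg))

open Classical in
lemma comp_matchStep (hf : Comp f) : Comp fun m γ => matchStep m (f m γ) :=
  .ite (.exists_lt 0 (.exists_lt 0 (.and
    (.eq hf.weaken.weaken ((Comp.var.weaken.regMul 0).add .var))
    (.and (compP_adjacent Comp.var.weaken .var)
    (.not (.exists_lt 0 (.exists_lt 0 (.and (compP_matched Comp.var.weaken .var)
      (.or (.or (.eq Comp.var.weaken Comp.var.weaken.weaken.weaken)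
        (.eq Comp.var.weaken Comp.var.weaken.weaken))
        (.or (.eq .var Comp.var.weaken.weaken.weaken) (.eq .var Comp.var.weaken.weaken)))))))))))
    (.const 1) (.const 0)

open Classical in
lemma comp_coverStep (hf : Comp f) : Comp fun m γ => coverStep m (f m γ) :=
  .ite (.exists_lt 0 (.exists_lt 0 (.and (compP_matched Comp.var.weaken .var)
    (.or (.eq Comp.var.weaken hf.weaken.weaken) (.eq .var hf.weaken.weaken)))))
    (.const 1) (.const 0)

lemma compP_inCover (hf : Comp f) : CompP fun m γ => InCover m (f m γ) :=
  .ne_zero (.arr 4 hf)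

lemma comp_rank (hf : Comp f) : Comp fun m γ => rank m (f m γ) :=
  .count 0 (.and (.lt .var hf.weaken) (compP_inCover .var))

lemma compP_reached (hf : Comp f) (hg : Comp g) (hh : Comp h) :
    CompP fun m γ => Reached m (f m γ) (g m γ) (h m γ) :=
  .ne_zero (.arr 5 ((hf.regMul 2).add ((hg.regMul 0).add hh)))

open Classical in
lemma comp_reachStep (hf : Comp f) : Comp fun m γ => reachStep m (f m γ) :=
  .ite (.exists_lt 4 (.exists_lt 0 (.exists_lt 0 (.and
    (.eq hf.weaken.weaken.weaken ((Comp.var.weaken.weaken.regMul 2).add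
      ((Comp.var.weaken.regMul 0).add .var)))
    (.or (.and (.eq Comp.var.weaken.weaken (.const 0)) (.eq Comp.var.weaken .var))
      (.and (.ne_zero Comp.var.weaken.weaken)
      (.exists_lt 0 (.and
        (compP_reached (Comp.var.weaken.weaken.weaken.sub (.const 1)) Comp.var.weaken.weaken .var)
        (.or (.eq .var Comp.var.weaken) (compP_adjacent .var Comp.var.weaken))))))))))
    (.const 1) (.const 0)

lemma comp_capDist (hf : Comp f) (hg : Comp g) :
    Comp fun m γ => capDist m (f m γ) (g m γ) :=
  .count 4 (.not (compP_reached .var hf.weaken hg.weaken))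

lemma comp_powStep (hf : Comp f) : Comp fun m γ => powStep m (f m γ) :=
  .ite (.eq hf (.const 0)) (.const 1) (.regMul 5 (.arr 6 (hf.sub (.const 1))))

lemma comp_quot (hf : Comp f) (hg : Comp g) : Comp fun m γ => quot m (f m γ) (g m γ) :=
  .count 9 (.le (.sum 9 (.ite (.le .var Comp.var.weaken) (.arr 6 hg.weaken.weaken) (.const 0)))
    hf.weaken)

lemma comp_digit (hf : Comp f) (hg : Comp g) : Comp fun m γ => digit m (f m γ) (g m γ) :=
  .sub (comp_quot hf hg) (.regMul 5 (comp_quot hf (hg.add (.const 1))))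

lemma comp_codeDist (hf : Comp f) (hg : Comp g) :
    Comp fun m γ => codeDist m (f m γ) (g m γ) :=
  comp_digit hf (comp_rank hg)

lemma compP_valid (hf : Comp f) (hg : Comp g) : CompP fun m γ => Valid m (f m γ) (g m γ) :=
  .forall_lt 0 (.imp (compP_inCover .var)
    (.le (comp_codeDist hf.weaken .var) (comp_capDist .var hg.weaken)))

lemma compP_hits (hf : Comp f) (hg : Comp g) (hh : Comp h) :
    CompP fun m γ => Hits m (f m γ) (g m γ) (h m γ) :=
  .or (.eq hh (.reg 3)) (.exists_lt 0 (.and (compP_inCover .var)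
    (.and (.eq (comp_rank .var) hh.weaken)
      (.eq (comp_capDist .var hg.weaken) (comp_codeDist hf.weaken .var)))))

lemma compP_seesCover (hf : Comp f) (hg : Comp g) :
    CompP fun m γ => SeesCover m (f m γ) (g m γ) :=
  .and (compP_inCover hg) (.or (.and (compP_inCover hf) (.eq hf hg))
    (.and (.not (compP_inCover hf)) (compP_adjacent hf hg)))

lemma compP_contentWith (hf : Comp f) (hg : Comp g) (hh : Comp h) :
    CompP fun m γ => ContentWith m (f m γ) (g m γ) (h m γ) :=
  .or (.and (.eq hh (.reg 3)) (.forall_lt 0 (.not (compP_seesCover hg.weaken .var))))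
    (.exists_lt 0 (.and (.eq (comp_rank .var) hh.weaken)
      (.and (compP_seesCover hg.weaken .var)
      (.forall_lt 0 (.imp (compP_seesCover hg.weaken.weaken .var)
        (.le (comp_codeDist hf.weaken.weaken Comp.var.weaken)
          (comp_codeDist hf.weaken.weaken .var)))))))

lemma compP_isRep {b v : State → Γ → ℕ} (hf : Comp f) (hg : Comp g) (hh : Comp h) (hb : Comp b)
    (hv : Comp v) :
    CompP fun m γ => IsRep (m.reg 6) (fun u => m.arr 0 u = g m γ) (Valid m (f m γ))
      (Hits m (f m γ)) (digit m (h m γ)) (b m γ) (v m γ) :=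
  .and (.eq (.arr 0 hv) hg) (.and (compP_valid hf hv)
    (.forall_lt 6 (.imp (.eq (comp_digit hh.weaken .var) hb.weaken)
      (compP_hits hf.weaken hv.weaken .var))))

lemma compP_selected (hf : Comp f) (hg : Comp g) (hh : Comp h) (hk : Comp k) :
    CompP fun m γ => Selected m (f m γ) (g m γ) (h m γ) (k m γ) :=
  .and (.eq (.arr 0 hk) hg) (.or
    (.forall_lt 6 (.imp (.ne_zero (comp_digit hh.weaken .var))
      (.not (compP_contentWith hf.weaken hk.weaken .var))))
    (.exists_lt 5 (.and (.le (.const 2) .var) (.and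
      (.exists_lt 6 (.eq (comp_digit hh.weaken.weaken .var) Comp.var.weaken)) (.and
      (compP_isRep hf.weaken hg.weaken hh.weaken .var hk.weaken)
      (.forall_lt 0 (.imp (.lt .var hk.weaken.weaken)
        (.not (compP_isRep hf.weaken.weaken hg.weaken.weaken hh.weaken.weaken
          Comp.var.weaken .var)))))))))

lemma compP_admissible (hf : Comp f) (hg : Comp g) (hh : Comp h) :
    CompP fun m γ => Admissible m (f m γ) (g m γ) (h m γ) :=
  .forall_lt 0 (.imp (.eq (.arr 0 .var) hg.weaken) (.and
    (.imp (compP_selected hf.weaken hg.weaken hh.weaken .var) (compP_valid hf.weaken .var))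
    (.or (compP_selected hf.weaken hg.weaken hh.weaken .var)
      (.exists_lt 6 (.and (compP_contentWith hf.weaken.weaken Comp.var.weaken .var)
        (.exists_lt 0 (.and
          (compP_selected hf.weaken.weaken.weaken hg.weaken.weaken.weaken hh.weaken.weaken.weaken
            .var)
          (compP_hits hf.weaken.weaken.weaken .var Comp.var.weaken))))))))

lemma comp_selectedCard (hf : Comp f) (hg : Comp g) (hh : Comp h) :
    Comp fun m γ => selectedCard m (f m γ) (g m γ) (h m γ) :=
  .count 0 (compP_selected hf.weaken hg.weaken hh.weaken .var)

lemma comp_colorCost (hf : Comp f) (hg : Comp g) :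
    Comp fun m γ => colorCost m (f m γ) (g m γ) :=
  .count 10 (.not (.exists_lt 9 (.and
    (compP_admissible hf.weaken.weaken hg.weaken.weaken .var)
    (.le (comp_selectedCard hf.weaken.weaken hg.weaken.weaken .var) Comp.var.weaken))))

lemma comp_totalCost (hf : Comp f) : Comp fun m γ => totalCost m (f m γ) :=
  .sum 1 (comp_colorCost hf.weaken .var)

lemma comp_least (b : ℕ) {P : State → Γ → ℕ → Prop}
    (hP : CompP fun m (γ : (Γ × ℕ) × ℕ) => P m γ.1.1 γ.2) (hb : b < 16 := by norm_num) :
    Comp fun m γ => least (m.reg b) (P m γ) :=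
  .count b (.forall_lt b (.imp (.le .var Comp.var.weaken) (.not hP)) hb) hb

lemma comp_bestDist : Comp fun m (_ : Γ) => bestDist m :=
  comp_least 9 (.forall_lt 9 (.le (comp_totalCost Comp.var.weaken) (comp_totalCost .var)))

lemma comp_bestCode (hf : Comp f) : Comp fun m γ => bestCode m (f m γ) :=
  comp_least 9 (.and (compP_admissible comp_bestDist hf.weaken.weaken .var)
    (.le (comp_selectedCard comp_bestDist hf.weaken.weaken .var)
      (comp_colorCost comp_bestDist hf.weaken.weaken)))

open Classical in
lemma comp_outStep (hf : Comp f) : Comp fun m γ => outStep m (f m γ) :=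
  .ite (compP_selected comp_bestDist (.arr 0 hf) (comp_bestCode (.arr 0 hf)) hf)
    (.const 1) (.const 0)

end Comp

/-! ### Counting -/

lemma count_eq_range {N k : ℕ} {P : ℕ → Prop} (hk : k ≤ N) (h : ∀ t < N, P t ↔ t < k) :
    count N P = k := by
  classical
  have : {t ∈ range N | P t} = range k := by
    ext t
    simp only [mem_filter, mem_range]
    constructor
    · rintro ⟨h1, h2⟩
      exact (h t h1).1 h2
    · intro h1
      exact ⟨h1.trans_le hk, (h t (h1.trans_le hk)).2 h1⟩
  unfold count
  convert congrArg card this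
  exact (card_range k).symm

lemma count_congr {N : ℕ} {P Q : ℕ → Prop} (h : ∀ t < N, P t ↔ Q t) : count N P = count N Q := by
  classical
  unfold count
  congr 1
  ext t
  simp only [mem_filter, mem_range]
  exact and_congr_right (h t)

/-- The failures of an upward closed predicate form an initial segment, so counting them finds the
threshold, or `N` if there is none below `N`. -/
lemma count_not_le {N t : ℕ} {Q : ℕ → Prop} (hQ : ∀ t t', t ≤ t' → Q t → Q t') (ht : Q t) :
    count N (fun t => ¬ Q t) ≤ t := by
  classical
  calc _ ≤ #(range t) := by
        refine card_le_card fun u hu => ?_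
        simp only [mem_filter, mem_range] at hu ⊢
        by_contra! h
        exact hu.2 (hQ _ _ h ht)
    _ = t := card_range t

lemma count_not_spec {N : ℕ} {Q : ℕ → Prop} (hQ : ∀ t t', t ≤ t' → Q t → Q t')
    (h : count N (fun t => ¬ Q t) < N) : Q (count N fun t => ¬ Q t) := by
  classical
  by_contra hn
  have : #(range (count N (fun t => ¬ Q t) + 1)) ≤ count N fun t => ¬ Q t := by
    refine card_le_card fun u hu => ?_
    simp only [mem_filter, mem_range] at hu ⊢
    exact ⟨by omega, fun hu' => hn (hQ _ _ (by omega) hu')⟩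
  simp at this

lemma least_spec {N t : ℕ} {P : ℕ → Prop} (ht : t < N) (hP : P t) :
    least N P < N ∧ P (least N P) := by
  set Q : ℕ → Prop := fun t => ∃ t' < N, t' ≤ t ∧ P t' with hQ
  have he : least N P = count N fun t => ¬ Q t :=
    count_congr fun t _ => by simp [hQ]
  have hmono : ∀ t t', t ≤ t' → Q t → Q t' := fun t t' h ⟨u, hu, hu', hPu⟩ =>
    ⟨u, hu, hu'.trans h, hPu⟩
  have hle : ∀ u < N, P u → least N P ≤ u := fun u hu hPu =>
    he ▸ count_not_le hmono ⟨u, hu, le_rfl, hPu⟩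
  have hlt := (hle t ht hP).trans_lt ht
  obtain ⟨u, hu, hu', hPu⟩ := count_not_spec hmono (he ▸ hlt)
  rw [← he] at hu'
  exact ⟨hlt, le_antisymm (hle u hu hPu) hu' ▸ hPu⟩

lemma rank_eq (m : State) {x : ℕ} (hx : x ≤ m.reg 0) : rank m x = count x (InCover m) := by
  classical
  unfold rank count
  congr 1
  ext y
  simp only [mem_filter, mem_range]
  constructor
  · rintro ⟨-, h1, h2⟩
    exact ⟨h1, h2⟩
  · rintro ⟨h1, h2⟩
    exact ⟨h1.trans_le hx, h1, h2⟩

lemma count_lt_count {P : ℕ → Prop} {x y : ℕ} (hxy : x < y) (hx : P x) : count x P < count y P := by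
  classical
  refine card_lt_card (ssubset_iff_of_subset ?_ |>.2 ⟨x, ?_, ?_⟩)
  · exact filter_subset_filter _ (range_subset_range.2 hxy.le)
  · simp [hxy, hx]
  · simp

lemma rank_lt (m : State) {x : ℕ} (hx : x < m.reg 0) (h : InCover m x) :
    rank m x < count (m.reg 0) (InCover m) := by
  rw [rank_eq m hx.le]
  exact count_lt_count hx h

lemma rank_inj (m : State) {x y : ℕ} (hx : x < m.reg 0) (hy : y < m.reg 0) (hcx : InCover m x)
    (hcy : InCover m y) (h : rank m x = rank m y) : x = y := by
  rw [rank_eq m hx.le, rank_eq m hy.le] at h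
  rcases lt_trichotomy x y with hlt | rfl | hlt
  · exact absurd h (count_lt_count hlt hcx).ne
  · rfl
  · exact absurd h (count_lt_count hlt hcy).ne'

/-! ### Digits -/

/-- The quotient is the number of t with (t + 1) · p ≤ N for the divisor p; as N < `m.reg 9`, the
range of t is long enough. -/
lemma quot_eq {m : State} {N j : ℕ} (hN : N < m.reg 9) (hj : 0 < m.arr 6 j) :
    quot m N j = N / m.arr 6 j := by
  refine count_eq_range ((Nat.div_le_self _ _).trans hN.le) fun t ht => ?_
  have : ∑ i ∈ range (m.reg 9), (if i ≤ t then m.arr 6 j else 0) = (t + 1) * m.arr 6 j := by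
    rw [← sum_filter, sum_const, smul_eq_mul]
    congr 1
    have : {i ∈ range (m.reg 9) | i ≤ t} = range (t + 1) := by
      ext i
      simp only [mem_filter, mem_range]
      omega
    rw [this, card_range]
  rw [this, ← Nat.le_div_iff_mul_le hj]
  omega

lemma digit_eq {m : State} {N j : ℕ} (hN : N < m.reg 9) (h0 : 0 < m.reg 5)
    (hj : m.arr 6 j = m.reg 5 ^ j) (hj' : m.arr 6 (j + 1) = m.reg 5 ^ (j + 1)) :
    digit m N j = N / m.reg 5 ^ j % m.reg 5 := by
  rw [digit, quot_eq hN (hj ▸ Nat.pow_pos h0), quot_eq hN (hj' ▸ Nat.pow_pos h0), hj, hj', pow_succ,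
    ← Nat.div_div_eq_div_mul]
  have := Nat.div_add_mod (N / m.reg 5 ^ j) (m.reg 5)
  omega

lemma exists_digit {m : State} {L : ℕ} (h0 : 0 < m.reg 5)
    (hpow : ∀ j ≤ L, m.arr 6 j = m.reg 5 ^ j) (h9 : m.reg 9 = m.reg 5 ^ L) {w : ℕ → ℕ}
    (hw : ∀ j < L, w j < m.reg 5) : ∃ N < m.reg 9, ∀ j < L, digit m N j = w j := by
  set N := finFunctionFinEquiv fun j : Fin L => (⟨w j, hw j j.2⟩ : Fin (m.reg 5)) with hN
  have hlt : (N : ℕ) < m.reg 9 := h9.symm ▸ N.2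
  refine ⟨N, hlt, fun j hj => ?_⟩
  rw [digit_eq hlt h0 (hpow j hj.le) (hpow _ hj)]
  have := congrArg Fin.val (congrFun (finFunctionFinEquiv.symm_apply_apply
    fun j : Fin L => (⟨w j, hw j j.2⟩ : Fin (m.reg 5))) ⟨j, hj⟩)
  rwa [← hN] at this

/-! ### The tables -/

lemma arr_fill_of_ne (a b : ℕ) (F : State → ℕ → ℕ) (m : State) {a' : ℕ} (h : a' ≠ a) :
    (fill a b F m).arr a' = m.arr a' :=
  fillUpTo_arr_of_ne a F m _ h

lemma index_lt {n u v : ℕ} (hu : u < n) (hv : v < n) : n * u + v < n * n := by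
  nlinarith [Nat.mul_le_mul_left n (Nat.succ_le_of_lt hu)]

lemma index_inj {n u v u' v' : ℕ} (hv : v < n) (hv' : v' < n) (h : n * u + v = n * u' + v') :
    u = u' ∧ v = v' := by
  have h1 : u = u' := by
    have := congrArg (· / n) h
    simpa [Nat.mul_add_div (Nat.zero_lt_of_lt hv), Nat.div_eq_of_lt hv, Nat.div_eq_of_lt hv']
      using this
  subst h1
  exact ⟨rfl, by omega⟩

/-! ### Greedy maximal matching -/

section Matching

variable {m : State} (h2 : m.reg 2 = m.reg 0 * m.reg 0) (h3 : ∀ e, m.arr 3 e = 0)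
include h2 h3

/-- When an entry is computed, it and all later entries still hold 0, so only edges selected earlier
can block it. -/
lemma matched_fill_iff {u v : ℕ} (hu : u < m.reg 0) (hv : v < m.reg 0) :
    Matched (fill 3 2 matchStep m) u v ↔ Adjacent m u v ∧
      ¬ ∃ a < m.reg 0, ∃ b < m.reg 0, (m.reg 0 * a + b < m.reg 0 * u + v ∧
        Matched (fill 3 2 matchStep m) a b) ∧ ((a = u ∨ a = v) ∨ (b = u ∨ b = v)) := by
  have hlt : m.reg 0 * u + v < m.reg 2 := h2 ▸ index_lt hu hv
  have hprev : ∀ a < m.reg 0, ∀ b < m.reg 0,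
      (Matched (fillUpTo 3 matchStep m (m.reg 0 * u + v)) a b ↔
        (m.reg 0 * a + b < m.reg 0 * u + v ∧ Matched (fill 3 2 matchStep m) a b)) := by
    intro a ha b hb
    have hlt' : m.reg 0 * a + b < m.reg 2 := h2 ▸ index_lt ha hb
    simp only [Matched, fill_reg, fillUpTo_reg]
    rcases Nat.lt_or_ge (m.reg 0 * a + b) (m.reg 0 * u + v) with h | h
    · rw [fillUpTo_arr_of_lt _ _ _ h, fill, fillUpTo_arr_of_lt _ _ _ hlt']
      simp [h]
    · rw [fillUpTo_arr_of_le _ _ _ h, h3]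
      simp [h]
  have hadj : ∀ a b, Adjacent (fillUpTo 3 matchStep m (m.reg 0 * u + v)) a b ↔ Adjacent m a b := by
    intro a b
    simp [Adjacent, fillUpTo_arr_of_ne]
  rw [Matched, fill_reg, fill, fillUpTo_arr_of_lt _ _ _ hlt]
  simp only [matchStep, fillUpTo_reg, hadj, ne_eq, ite_eq_right_iff, one_ne_zero, imp_false,
    not_not]
  constructor
  · rintro ⟨u', hu', v', hv', he, ha, hn⟩
    obtain ⟨rfl, rfl⟩ := index_inj hv hv' he
    refine ⟨ha, ?_⟩
    rintro ⟨a, ha, b, hb, hab, hs⟩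
    exact hn ⟨a, ha, b, hb, (hprev a ha b hb).2 hab, hs⟩
  · rintro ⟨ha, hn⟩
    refine ⟨u, hu, v, hv, rfl, ha, ?_⟩
    rintro ⟨a, ha, b, hb, hab, hs⟩
    exact hn ⟨a, ha, b, hb, (hprev a ha b hb).1 hab, hs⟩

/-- Of two selected edges that meet, the earlier would have blocked the later. This also excludes
selecting both orientations of an edge. -/
lemma matched_disjoint {u v a b : ℕ} (hu : u < m.reg 0) (hv : v < m.reg 0) (ha : a < m.reg 0)
    (hb : b < m.reg 0) (h : Matched (fill 3 2 matchStep m) u v)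
    (h' : Matched (fill 3 2 matchStep m) a b) (hs : (a = u ∨ a = v) ∨ (b = u ∨ b = v)) :
    u = a ∧ v = b := by
  rcases lt_trichotomy (m.reg 0 * u + v) (m.reg 0 * a + b) with hlt | heq | hlt
  · exact absurd ⟨u, hu, v, hv, ⟨hlt, h⟩, by omega⟩ ((matched_fill_iff h2 h3 ha hb).1 h').2
  · exact index_inj hv hb heq
  · exact absurd ⟨a, ha, b, hb, ⟨hlt, h'⟩, hs⟩ ((matched_fill_iff h2 h3 hu hv).1 h).2

lemma exists_matched {u v : ℕ} (hu : u < m.reg 0) (hv : v < m.reg 0) (h : Adjacent m u v) :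
    ∃ a < m.reg 0, ∃ b < m.reg 0, Matched (fill 3 2 matchStep m) a b ∧
      ((a = u ∨ a = v) ∨ (b = u ∨ b = v)) := by
  by_cases hm : Matched (fill 3 2 matchStep m) u v
  · exact ⟨u, hu, v, hv, hm, by simp⟩
  · rw [matched_fill_iff h2 h3 hu hv] at hm
    push Not at hm
    obtain ⟨a, ha, b, hb, ⟨-, hab⟩, hs⟩ := hm h
    exact ⟨a, ha, b, hb, hab, hs⟩

end Matching

lemma inCover_fill_iff {m : State} {v : ℕ} (hv : v < m.reg 0) :
    InCover (fill 4 0 coverStep m) v ↔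
      ∃ a < m.reg 0, ∃ b < m.reg 0, Matched m a b ∧ (a = v ∨ b = v) := by
  rw [InCover, fill, fillUpTo_arr_of_lt _ _ _ hv]
  simp [coverStep, Matched, fillUpTo_arr_of_ne, or_iff_not_imp_left]

lemma arr_fill_pow {m : State} {j : ℕ} (hj : j < m.reg 7) :
    (fill 6 7 powStep m).arr 6 j = m.reg 5 ^ j := by
  induction j with
  | zero => rw [fill, fillUpTo_arr_of_lt _ _ _ hj]; simp [powStep]
  | succ j ih =>
    rw [fill, fillUpTo_arr_of_lt _ _ _ hj, powStep, if_neg (Nat.succ_ne_zero j), fillUpTo_reg,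
      Nat.add_sub_cancel, fillUpTo_arr_of_lt _ _ _ (Nat.lt_succ_self j), pow_succ', ← ih (by omega),
      fill, fillUpTo_arr_of_lt _ _ _ (by omega)]

/-! ### Reachability by walks of bounded length -/

section Reach

variable {m : State} (h2 : m.reg 2 = m.reg 0 * m.reg 0) (h8 : m.reg 8 = m.reg 4 * m.reg 2)
include h2 h8

/-- The index is ordered by t first, so the layer t - 1 is complete before layer t is begun and
already has its final values. -/
lemma reached_fill_iff {t u v : ℕ} (ht : t < m.reg 4) (hu : u < m.reg 0) (hv : v < m.reg 0) :
    Reached (fill 5 8 reachStep m) t u v ↔ (t = 0 ∧ u = v) ∨ (t ≠ 0 ∧ ∃ w < m.reg 0,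
      Reached (fill 5 8 reachStep m) (t - 1) u w ∧ (w = v ∨ Adjacent m w v)) := by
  have hidx : ∀ {t u v}, t < m.reg 4 → u < m.reg 0 → v < m.reg 0 →
      m.reg 2 * t + (m.reg 0 * u + v) < m.reg 8 := by
    intro t u v ht hu hv
    have := index_lt hu hv
    rw [h8]
    nlinarith [Nat.mul_le_mul_right (m.reg 2) (Nat.succ_le_of_lt ht)]
  have hadj : ∀ a b, Adjacent (fillUpTo 5 reachStep m (m.reg 2 * t + (m.reg 0 * u + v))) a b ↔
      Adjacent m a b := by
    intro a b
    simp [Adjacent, fillUpTo_arr_of_ne]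
  have hprev : t ≠ 0 → ∀ w < m.reg 0,
      (Reached (fillUpTo 5 reachStep m (m.reg 2 * t + (m.reg 0 * u + v))) (t - 1) u w ↔
        Reached (fill 5 8 reachStep m) (t - 1) u w) := by
    intro h0 w hw
    have hlt : m.reg 2 * (t - 1) + (m.reg 0 * u + w) < m.reg 2 * t + (m.reg 0 * u + v) := by
      have := index_lt hu hw
      obtain ⟨t, rfl⟩ := Nat.exists_eq_succ_of_ne_zero h0
      simp only [Nat.succ_eq_add_one, Nat.add_sub_cancel, mul_add]
      omega
    simp only [Reached, fill_reg, fillUpTo_reg]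
    rw [fillUpTo_arr_of_lt _ _ _ hlt, fill, fillUpTo_arr_of_lt _ _ _ (hidx (by omega) hu hw)]
  rw [Reached, fill_reg, fill, fillUpTo_arr_of_lt _ _ _ (hidx ht hu hv)]
  simp only [reachStep, fillUpTo_reg, hadj, ne_eq, ite_eq_right_iff, one_ne_zero, imp_false,
    not_not]
  rw [← fill]
  constructor
  · rintro ⟨t', ht', u', hu', v', hv', he, h⟩
    obtain ⟨rfl, he'⟩ := index_inj (h2 ▸ index_lt hu hv) (h2 ▸ index_lt hu' hv') he
    obtain ⟨rfl, rfl⟩ := index_inj hv hv' he'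
    refine h.imp_right fun ⟨h0, w, hw, hr, hwv⟩ => ⟨h0, w, hw, (hprev h0 w hw).1 hr, hwv⟩
  · intro h
    exact ⟨t, ht, u, hu, v, hv, rfl,
      h.imp_right fun ⟨h0, w, hw, hr, hwv⟩ => ⟨h0, w, hw, (hprev h0 w hw).2 hr, hwv⟩⟩

lemma reached_iff_edist {n : ℕ} {G : SimpleGraph (Fin n)} (hn : m.reg 0 = n)
    (hadj : ∀ u v : Fin n, Adjacent m u v ↔ G.Adj u v) {t : ℕ} (ht : t < m.reg 4) (u v : Fin n) :
    Reached (fill 5 8 reachStep m) t u v ↔ G.edist u v ≤ t := by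
  subst hn
  induction t generalizing v with
  | zero => simp [reached_fill_iff h2 h8 ht u.2 v.2, Fin.ext_iff]
  | succ t ih =>
    rw [reached_fill_iff h2 h8 ht u.2 v.2, edist_le_succ_iff]
    simp only [Nat.succ_ne_zero, false_and, false_or, ne_eq, not_false_eq_true, true_and,
      Nat.add_sub_cancel]
    constructor
    · rintro ⟨w, hw, hr, h⟩
      refine ⟨⟨w, hw⟩, (ih (by omega) ⟨w, hw⟩).1 hr, h.imp (fun h => Fin.ext h) fun h => ?_⟩
      exact (hadj ⟨w, hw⟩ v).1 h
    · rintro ⟨w, hr, h⟩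
      exact ⟨w, w.2, (ih (by omega) w).2 hr, h.imp (fun h => congrArg _ h) (hadj w v).2⟩

end Reach

/-- The endpoints of a matching are at most twice as many as the vertices of a vertex cover. -/
lemma card_endpoints_le {V : Type*} [DecidableEq V] {G : SimpleGraph V} {A : Finset (V × V)}
    (hadj : ∀ p ∈ A, G.Adj p.1 p.2)
    (hdisj : ∀ p ∈ A, ∀ q ∈ A, ((q.1 = p.1 ∨ q.1 = p.2) ∨ (q.2 = p.1 ∨ q.2 = p.2)) → p = q)
    {Y : Finset V} (hY : G.IsVertexCover (Y : Set V)) :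
    #(A.image Prod.fst ∪ A.image Prod.snd) ≤ 2 * #Y := by
  have h : #A ≤ #Y := by
    refine card_le_card_of_injOn (fun p => if p.1 ∈ Y then p.1 else p.2) ?_ ?_
    · intro p hp
      dsimp only
      split_ifs with h
      · exact h
      · exact (hY (hadj p hp)).resolve_left h
    · intro p hp q hq hpq
      refine hdisj p hp q hq ?_
      dsimp only at hpq
      split_ifs at hpq <;> simp [hpq]
  calc _ ≤ _ := card_union_le _ _
    _ ≤ #A + #A := add_le_add card_image_le card_image_le
    _ ≤ 2 * #Y := by omega

/-! ### Optimality of the selection -/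

/-- The memory holds the instance and the tables that the search needs. -/
structure Ready {n c : ℕ} (G : SimpleGraph (Fin n)) (χ : Fin n → Fin c) (K : ℕ) (m : State) :
    Prop where
  reg0 : m.reg 0 = n
  reg1 : m.reg 1 = c
  reg3 : m.reg 3 = K
  reg4 : m.reg 4 = 2 * K + 1
  reg5 : m.reg 5 = 2 * K + 4
  reg6 : m.reg 6 = K + 1
  reg9 : m.reg 9 = (2 * K + 4) ^ (K + 1)
  reg10 : m.reg 10 = n + 1
  color : ∀ v : Fin n, m.arr 0 v = χ v
  adj : ∀ u v : Fin n, Adjacent m u v ↔ G.Adj u v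
  card : K = count n (InCover m)
  cover : G.IsVertexCover {v : Fin n | InCover m v}
  reached : ∀ t < 2 * K + 1, ∀ u v : Fin n, Reached m t u v ↔ G.edist u v ≤ t
  pow : ∀ j ≤ K + 1, m.arr 6 j = (2 * K + 4) ^ j

lemma card_filter_fin {n : ℕ} (P : ℕ → Prop) [DecidablePred fun v : Fin n => P v] :
    #{v : Fin n | P v} = count n P := by
  classical
  unfold count
  rw [← card_map Fin.valEmbedding]
  congr 1
  ext t
  simp only [mem_map, mem_filter, mem_univ, true_and, Fin.valEmbedding_apply, mem_range]
  constructor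
  · rintro ⟨v, hv, rfl⟩
    exact ⟨v.2, hv⟩
  · rintro ⟨ht, hP⟩
    exact ⟨⟨t, ht⟩, hP, rfl⟩

namespace Ready

variable {n c K : ℕ} {G : SimpleGraph (Fin n)} {χ : Fin n → Fin c} {m : State}
  (h : Ready G χ K m)
include h

lemma isCapped : IsCapped G (2 * K + 1) fun u v => capDist m u v := by
  classical
  refine isCapped_of_card (fun u v huv => ?_) fun u v => ?_
  · have hX : G.IsVertexCover (({v : Fin n | InCover m v} : Finset (Fin n)) : Set (Fin n)) := by
      simpa using h.cover
    refine (edist_le_two_mul_card hX huv).trans_lt ?_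
    rw [card_filter_fin, ← h.card]
    exact_mod_cast Nat.lt_succ_self _
  · rw [capDist, h.reg4]
    trans count (2 * K + 1) fun t => ¬ G.edist u v ≤ t
    · exact count_congr fun t ht => not_congr (h.reached t ht u v)
    · unfold count
      congr!

lemma seesCover_iff {v x : Fin n} :
    SeesCover m v x ↔ Sees G {v : Fin n | InCover m v} v x := by
  simp [SeesCover, Sees, h.adj, Fin.ext_iff]

lemma rank_lt {x : Fin n} (hx : InCover m x) : rank m x < K := by
  have := MCS.rank_lt m (h.reg0.symm ▸ x.2) hx
  rwa [h.reg0, ← h.card] at this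

lemma rank_inj {x y : Fin n} (hx : InCover m x) (hy : InCover m y) (hxy : rank m x = rank m y) :
    x = y :=
  Fin.ext (MCS.rank_inj m (h.reg0.symm ▸ x.2) (h.reg0.symm ▸ y.2) hx hy hxy)

/-- The base 2K + 4 serves both kinds of codes: capped distances are at most 2K + 1, and the block
labels need L + 2 = K + 3 values. -/
lemma exists_code {w : ℕ → ℕ} (hw : ∀ j < K + 1, w j < 2 * K + 4) :
    ∃ N < m.reg 9, ∀ j < K + 1, digit m N j = w j :=
  exists_digit (by rw [h.reg5]; omega) (fun j hj => by rw [h.reg5, h.pow j hj])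
    (by rw [h.reg5, h.reg9]) (fun j hj => by rw [h.reg5]; exact hw j hj)

/-- A selection with admissible codes for all colours is a consistent subset. -/
lemma isConsistent {z : ℕ} {g : ℕ → ℕ} (hg : ∀ v : Fin n, Admissible m z (χ v) (g (χ v))) :
    IsConsistent G χ {v : Fin n | Selected m z (χ v) (g (χ v)) v} := by
  have hadm : ∀ v : Fin n, _ := fun v => hg v v (h.reg0.symm ▸ v.2) (h.color v)
  refine isConsistent_of_content h.cover h.isCapped (d := fun x => codeDist m z x) ?_ fun v => ?_
  · intro s hs x hx
    exact (hadm s).1 hs x (h.reg0.symm ▸ x.2) hx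
  · obtain hv | ⟨j, hj, hcj, s, hsn, hs, hsj⟩ := (hadm v).2
    · exact .inl hv
    · rw [h.reg0] at hsn
      obtain ⟨s, rfl⟩ : ∃ s' : Fin n, (s' : ℕ) = s := ⟨⟨s, hsn⟩, rfl⟩
      have hχ : χ s = χ v := Fin.ext ((h.color s).symm.trans hs.1)
      -- The vertex s was selected for the colour of v, which is also its own; hence it lies in the
      -- union of the selections.
      rw [← hχ] at hs
      rcases hcj with ⟨-, hiso⟩ | ⟨x, hxn, rfl, hsees, hmin⟩
      · exact .inr (.inl ⟨fun x hx => hiso x (h.reg0.symm ▸ x.2) (h.seesCover_iff.2 hx), s, hs, hχ⟩)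
      · rw [h.reg0] at hxn
        obtain ⟨x, rfl⟩ : ∃ x' : Fin n, (x' : ℕ) = x := ⟨⟨x, hxn⟩, rfl⟩
        refine .inr (.inr ⟨x, h.seesCover_iff.1 hsees,
          fun y hy => hmin y (h.reg0.symm ▸ y.2) (h.seesCover_iff.2 hy), s, hs, hχ, ?_⟩)
        have hx := hsees.1
        -- Ranks of cover vertices are below K, so the item of x is not the extra one, and
        -- injectivity of the rank identifies x' with x.
        rcases hsj with hK | ⟨x', hxn', hx', hr, hd⟩
        · rw [h.reg3] at hK
          exact absurd hK (h.rank_lt hx).ne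
        · rw [h.reg0] at hxn'
          obtain ⟨x', rfl⟩ : ∃ y : Fin n, (y : ℕ) = x' := ⟨⟨x', hxn'⟩, rfl⟩
          obtain rfl := h.rank_inj hx' hx hr
          exact hd

lemma exists_dist_code {d : Fin n → ℕ} (hd : ∀ x, d x ≤ 2 * K + 1) :
    ∃ z < m.reg 9, ∀ x : Fin n, InCover m x → codeDist m z x = d x := by
  classical
  obtain ⟨z, hz, hzd⟩ := h.exists_code
    -- Digits that belong to no cover vertex, such as digit K, are irrelevant and set to 0.
    (w := fun j => if hj : ∃ x : Fin n, InCover m x ∧ rank m x = j then d hj.choose else 0) (by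
      intro j _
      split_ifs with hj
      · have := hd hj.choose
        omega
      · omega)
  refine ⟨z, hz, fun x hx => ?_⟩
  have hex : ∃ y : Fin n, InCover m y ∧ rank m y = rank m x := ⟨x, hx, rfl⟩
  have hrx := h.rank_lt hx
  rw [codeDist, hzd _ (by omega), dif_pos hex, h.rank_inj hex.choose_spec.1 hx hex.choose_spec.2]

open Classical in
-- A single code z, obtained from a certificate d for `T`, works for all colours at once. Each
-- colour class of `T` is feasible for it, and `exists_cand_le` replaces the class by a coded
-- selection that is no larger.
lemma exists_colorCost_le {T : Finset (Fin n)} (hT : IsConsistent G χ (T : Set (Fin n))) :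
    ∃ z < m.reg 9, ∀ i : Fin c, colorCost m z i ≤ #{v ∈ T | χ v = i} := by
  obtain ⟨d, hdM, hdT, hcont⟩ := exists_content_of_isConsistent h.cover h.isCapped hT
  obtain ⟨z, hz, hzd⟩ := h.exists_dist_code hdM
  refine ⟨z, hz, fun i => ?_⟩
  set S : ℕ → Prop := fun v => ∃ s : Fin n, (s : ℕ) = v ∧ s ∈ T ∧ χ s = i with hSdef
  have hS : ∀ v, S v → v < m.reg 0 ∧ m.arr 0 v = i := by
    rintro _ ⟨s, rfl, -, rfl⟩
    exact ⟨h.reg0.symm ▸ s.2, h.color s⟩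
  have hcard : count (m.reg 0) S = #{v ∈ T | χ v = i} := by
    rw [h.reg0, ← card_filter_fin]
    congr 1
    ext v
    simp only [hSdef, mem_filter, mem_univ, true_and]
    constructor
    · rintro ⟨s, hs, h'⟩
      rwa [← Fin.ext hs]
    · exact fun h' => ⟨v, rfl, h'⟩
  have hf : Feasible (m.reg 0) (m.reg 6) (fun v => m.arr 0 v = i) (Valid m z) (Hits m z)
      (ContentWith m z) S := by
    intro v hvn hvi
    rw [h.reg0] at hvn
    obtain ⟨v, rfl⟩ : ∃ v' : Fin n, (v' : ℕ) = v := ⟨⟨v, hvn⟩, rfl⟩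
    have hvi : χ v = i := Fin.ext ((h.color v).symm.trans hvi)
    constructor
    · rintro ⟨s, hsv, hsT, -⟩ x hx hxc
      rw [← hsv]
      rw [h.reg0] at hx
      exact (hzd ⟨x, hx⟩ hxc).trans_le (hdT s hsT ⟨x, hx⟩ hxc)
    · rw [h.reg6, h.reg0]
      obtain hv | ⟨hiso, s, hsT, hχ⟩ | ⟨x, hx, hmin, s, hsT, hχ, hd⟩ := hcont v
      · exact .inl ⟨v, rfl, hv, hvi⟩
      · refine .inr ⟨K, Nat.lt_succ_self K, .inl ⟨h.reg3.symm, fun x hx hsx => ?_⟩, s, s.2,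
          ⟨s, rfl, hsT, hχ.trans hvi⟩, .inl h.reg3.symm⟩
        rw [h.reg0] at hx
        exact hiso ⟨x, hx⟩ ((h.seesCover_iff (x := ⟨x, hx⟩)).1 hsx)
      · have hxc : InCover m x := hx.1
        refine .inr ⟨rank m x, (h.rank_lt hxc).trans (Nat.lt_succ_self K),
          .inr ⟨x, h.reg0.symm ▸ x.2, rfl, h.seesCover_iff.2 hx, fun y hy hsy => ?_⟩, s, s.2,
          ⟨s, rfl, hsT, hχ.trans hvi⟩,
          .inr ⟨x, h.reg0.symm ▸ x.2, hxc, rfl, hd.trans (hzd x hxc).symm⟩⟩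
        rw [h.reg0] at hy
        rw [hzd x hxc]
        exact (hmin ⟨y, hy⟩ ((h.seesCover_iff (x := ⟨y, hy⟩)).1 hsy)).trans_eq
          (hzd ⟨y, hy⟩ hsy.1).symm
  obtain ⟨g, hgB, hgf, hgc⟩ := exists_cand_le (B := m.reg 5) hS
    (by rw [h.reg5, h.reg6]; omega) hf
  obtain ⟨N, hN, hNg⟩ := h.exists_code (w := g) fun j _ => h.reg5 ▸ hgB j
  rw [← h.reg6] at hNg
  have hsel : Selected m z i N = Cand (m.reg 0) (m.reg 6) (m.reg 5) (fun v => m.arr 0 v = i)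
      (Valid m z) (Hits m z) (ContentWith m z) g := cand_congr hNg
  rw [← hsel] at hgf hgc
  refine count_not_le (fun t t' htt ⟨g, hg, ha, hle⟩ => ⟨g, hg, ha, hle.trans htt⟩)
    ⟨N, hN, hgf, ?_⟩
  rw [← hcard]
  exact hgc

lemma totalCost_bestDist_le {T : Finset (Fin n)} (hT : IsConsistent G χ (T : Set (Fin n))) :
    totalCost m (bestDist m) ≤ #T := by
  classical
  obtain ⟨z, hz, hzT⟩ := h.exists_colorCost_le hT
  have hmin : ∃ t < m.reg 9, ∀ z < m.reg 9, totalCost m t ≤ totalCost m z := by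
    obtain ⟨t, ht, hmin⟩ := exists_min_image (range (m.reg 9)) (totalCost m) ⟨z, by simpa using hz⟩
    exact ⟨t, by simpa using ht, fun z hz => hmin z (by simpa using hz)⟩
  obtain ⟨t, ht, hmin⟩ := hmin
  refine ((least_spec (P := fun t => ∀ z < m.reg 9, totalCost m t ≤ totalCost m z)
    ht hmin).2 z hz).trans ?_
  rw [totalCost, h.reg1, sum_range, card_eq_sum_card_fiberwise (f := χ) (t := univ) (by simp)]
  exact sum_le_sum fun i _ => hzT i

/-- A colour without admissible selection costs n + 1. As the set of all vertices is consistent, the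
optimal total is at most n, so the best guess leaves no colour without one. -/
lemma colorCost_bestDist_le (i : Fin c) : colorCost m (bestDist m) i ≤ n := by
  have huniv : IsConsistent G χ ((univ : Finset (Fin n)) : Set (Fin n)) := by
    rw [h.isCapped.isConsistent_iff]
    exact fun v => ⟨v, by simp, rfl, fun u _ => h.isCapped.self_le v v u⟩
  calc colorCost m (bestDist m) i ≤ totalCost m (bestDist m) :=
        single_le_sum (f := colorCost m (bestDist m)) (fun _ _ => Nat.zero_le _)
          (by rw [h.reg1]; simp)
    _ ≤ n := by simpa using h.totalCost_bestDist_le huniv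

lemma selected_best (i : Fin c) : Admissible m (bestDist m) i (bestCode m i) ∧
    selectedCard m (bestDist m) i (bestCode m i) ≤ colorCost m (bestDist m) i := by
  obtain ⟨g, hg, hga⟩ : ∃ g < m.reg 9, Admissible m (bestDist m) i g ∧
      selectedCard m (bestDist m) i g ≤ colorCost m (bestDist m) i := by
    refine count_not_spec (N := m.reg 10) (Q := fun t => ∃ g < m.reg 9,
      Admissible m (bestDist m) i g ∧ selectedCard m (bestDist m) i g ≤ t)
      (fun t t' htt ⟨g, hg, ha, hle⟩ => ⟨g, hg, ha, hle.trans htt⟩) ?_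
    have := h.colorCost_bestDist_le i
    exact (Nat.lt_succ_of_le this).trans_eq h.reg10.symm
  exact (least_spec (P := fun g => Admissible m (bestDist m) i g ∧
      selectedCard m (bestDist m) i g ≤ colorCost m (bestDist m) i) hg hga).2

open Classical in
theorem isMinimumConsistent : IsMinimumConsistent G χ
    {v : Fin n | Selected m (bestDist m) (χ v) (bestCode m (χ v)) v} := by
  refine ⟨?_, fun T hT => ?_⟩
  · simpa using h.isConsistent fun v => (h.selected_best (χ v)).1
  · refine le_trans ?_ (h.totalCost_bestDist_le hT)
    rw [totalCost, h.reg1, sum_range, card_eq_sum_card_fiberwise (f := χ) (t := univ) (by simp)]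
    refine sum_le_sum fun i _ => le_trans (le_of_eq ?_) (h.selected_best i).2
    rw [selectedCard, h.reg0, ← card_filter_fin, filter_filter]
    congr 1
    ext v
    simp only [mem_filter, mem_univ, true_and]
    constructor
    · rintro ⟨hv, rfl⟩
      exact hv
    · intro hv
      have : χ v = i := Fin.ext ((h.color v).symm.trans hv.1)
      rw [this]
      exact ⟨hv, rfl⟩

end Ready

/-! ### The algorithm -/

/-- The output does not depend on array `2`. -/
lemma outStep_congr {m m' : State} (hr : m'.reg = m.reg) (ha : ∀ a ≠ 2, m'.arr a = m.arr a) :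
    outStep m' = outStep m := by
  have h0 := ha 0 (by norm_num)
  have h1 : Adjacent m' = Adjacent m := by funext; simp only [Adjacent, hr, ha 1 (by norm_num)]
  have h2 : InCover m' = InCover m := by funext; simp only [InCover, ha 4 (by norm_num)]
  have h3 : rank m' = rank m := by funext; simp only [rank, hr, h2]
  have h4 : Reached m' = Reached m := by funext; simp only [Reached, hr, ha 5 (by norm_num)]
  have h5 : capDist m' = capDist m := by funext; simp only [capDist, hr, h4]
  have h6 : quot m' = quot m := by funext; simp only [quot, hr, ha 6 (by norm_num)]
  have h7 : digit m' = digit m := by funext; simp only [digit, hr, h6]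
  have h8 : codeDist m' = codeDist m := by funext; simp only [codeDist, h3, h7]
  have h9 : Valid m' = Valid m := by funext; simp only [Valid, hr, h2, h5, h8]
  have h10 : Hits m' = Hits m := by funext; simp only [Hits, hr, h2, h3, h5, h8]
  have h11 : SeesCover m' = SeesCover m := by funext; simp only [SeesCover, h1, h2]
  have h12 : ContentWith m' = ContentWith m := by
    funext; simp only [ContentWith, hr, h3, h8, h11]
  have h13 : Selected m' = Selected m := by
    funext; simp only [Selected, hr, h0, h7, h9, h10, h12]
  have h14 : Admissible m' = Admissible m := by
    funext; simp only [Admissible, hr, h0, h9, h10, h12, h13]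
  have h15 : selectedCard m' = selectedCard m := by funext; simp only [selectedCard, hr, h13]
  have h16 : colorCost m' = colorCost m := by funext; simp only [colorCost, hr, h14, h15]
  have h17 : totalCost m' = totalCost m := by funext; simp only [totalCost, hr, h16]
  have h18 : bestDist m' = bestDist m := by simp only [bestDist, hr, h17]
  have h19 : bestCode m' = bestCode m := by
    funext; simp only [bestCode, hr, h14, h15, h16, h18]
  funext
  rw [outStep, outStep, h0, h13, h18, h19]

noncomputable def coverPhase (m : State) : State :=
  fill 4 0 coverStep (fill 3 2 matchStep (assign 2 (fun m => m.reg 0 * m.reg 0) m))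

noncomputable def sizePhase (m : State) : State :=
  assign 8 (fun m => m.reg 4 * m.reg 2) <| assign 7 (fun m => m.reg 3 + 2) <|
  assign 6 (fun m => m.reg 3 + 1) <| assign 5 (fun m => m.reg 3 + m.reg 3 + 4) <|
  assign 4 (fun m => m.reg 3 + m.reg 3 + 1) <| assign 3 (fun m => count (m.reg 0) (InCover m)) m

noncomputable def tablePhase (m : State) : State :=
  assign 10 (fun m => m.reg 0 + 1) <| assign 9 (fun m => m.arr 6 (m.reg 6)) <|
  fill 6 7 powStep <| fill 5 8 reachStep m

/-- The memory before the output is written. -/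
noncomputable def prepared (m : State) : State := tablePhase (sizePhase (coverPhase m))

section Achieves

variable {ι : Type} {a : ι → State}

lemma achieves_coverPhase (ha : ∀ i, (a i).reg 2 = 0) :
    Achieves a fun i => coverPhase (a i) := by
  have h2 := (Achieves.refl a).assign 2 (fun m => m.reg 0 * m.reg 0)
    (Comp.regMul 0 (f := fun m _ => m.reg 0) (.reg 0)) ha
  exact (h2.trans (achieves_fill 3 2 (comp_matchStep .var))).trans
    (achieves_fill 4 0 (comp_coverStep .var))

lemma achieves_sizePhase (ha : ∀ i r, 3 ≤ r → (a i).reg r = 0) :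
    Achieves a fun i => sizePhase (a i) := by
  have h3 := (Achieves.refl a).assign 3 (fun m => count (m.reg 0) (InCover m))
    (Comp.count 0 (P := fun m _ => InCover m) (compP_inCover .var)) fun i => ha i 3 le_rfl
  have h4 := h3.assign 4 (fun m => m.reg 3 + m.reg 3 + 1)
    (((Comp.reg 3).add (.reg 3)).add (.const 1)) fun i => by simp [assign, ha]
  have h5 := h4.assign 5 (fun m => m.reg 3 + m.reg 3 + 4)
    (((Comp.reg 3).add (.reg 3)).add (.const 4)) fun i => by simp [assign, ha]
  have h6 := h5.assign 6 (fun m => m.reg 3 + 1) ((Comp.reg 3).add (.const 1))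
    fun i => by simp [assign, ha]
  have h7 := h6.assign 7 (fun m => m.reg 3 + 2) ((Comp.reg 3).add (.const 2))
    fun i => by simp [assign, ha]
  exact h7.assign 8 (fun m => m.reg 4 * m.reg 2)
    (Comp.regMul 4 (f := fun m _ => m.reg 2) (.reg 2)) fun i => by simp [assign, ha]

lemma achieves_tablePhase (ha : ∀ i r, 9 ≤ r → (a i).reg r = 0) :
    Achieves a fun i => tablePhase (a i) := by
  have h6 := (achieves_fill (d := a) 5 8 (comp_reachStep .var)).trans
    (achieves_fill 6 7 (comp_powStep .var))
  have h9 := h6.assign 9 (fun m => m.arr 6 (m.reg 6)) (.arr 6 (.reg 6)) fun i => by simp [ha]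
  exact h9.assign 10 (fun m => m.reg 0 + 1) ((Comp.reg 0).add (.const 1))
    fun i => by simp [assign, ha]

lemma achieves_output (ha : ∀ i r, 2 ≤ r → (a i).reg r = 0) :
    Achieves a fun i => fill 2 0 outStep (prepared (a i)) := by
  have hc := achieves_coverPhase fun i => ha i 2 le_rfl
  have hs := achieves_sizePhase (a := fun i => coverPhase (a i)) fun i r hr => by
    simp [coverPhase, assign, (show r ≠ 2 by omega), ha i r (by omega)]
  have ht := achieves_tablePhase (a := fun i => sizePhase (coverPhase (a i))) fun i r hr => by
    have hne : ∀ r' < 9, r ≠ r' := fun r' hr' => by omega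
    simp [sizePhase, coverPhase, assign, hne, ha i r (by omega)]
  exact ((hc.trans hs).trans ht).trans (achieves_fill 2 0 (comp_outStep .var))

end Achieves

/-! ### Contents and weight of the prepared memory -/

section Prepared

variable {n c : ℕ} (G : SimpleGraph (Fin n)) (χ : Fin n → Fin c)

lemma adjacent_input (u v : Fin n) : Adjacent (input G χ) u v ↔ G.Adj u v := by
  have : (∃ u' v' : Fin n, G.Adj u' v' ∧ n * (u : ℕ) + v = u' * n + v') ↔ G.Adj u v := by
    constructor
    · rintro ⟨u', v', h, he⟩
      rw [mul_comm (u' : ℕ)] at he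
      obtain ⟨h1, h2⟩ := index_inj v.2 v'.2 he
      rwa [Fin.ext h1, Fin.ext h2]
    · exact fun h => ⟨u, v, h, by rw [mul_comm]⟩
  simp [Adjacent, input, this]

/-- The memory that holds the instance and `n * n`. -/
noncomputable abbrev squared : State := assign 2 (fun m => m.reg 0 * m.reg 0) (input G χ)

lemma inCover_coverPhase {v : ℕ} (hv : v < n) : InCover (coverPhase (input G χ)) v ↔
    ∃ a < n, ∃ b < n, Matched (fill 3 2 matchStep (squared G χ)) a b ∧ (a = v ∨ b = v) := by
  have := inCover_fill_iff (m := fill 3 2 matchStep (squared G χ)) (v := v)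
  simp only [fill_reg] at this
  exact this (by simpa [squared, assign, input] using hv)

lemma isVertexCover_coverPhase :
    G.IsVertexCover {v : Fin n | InCover (coverPhase (input G χ)) v} := by
  intro u v huv
  have hr0 : (squared G χ).reg 0 = n := by simp [squared, assign, input]
  obtain ⟨a, ha, b, hb, hab, hs⟩ := exists_matched (m := squared G χ) (u := u) (v := v)
    (by simp [squared, assign, input]) (by simp [squared, assign, input])
    (hr0.symm ▸ u.2) (hr0.symm ▸ v.2) ((adjacent_input G χ u v).2 huv)
  rw [hr0] at ha hb
  simp only [Set.mem_ofPred_eq]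
  rw [inCover_coverPhase G χ u.2, inCover_coverPhase G χ v.2]
  rcases hs with (h | h) | (h | h)
  · exact .inl ⟨a, ha, b, hb, hab, .inl h⟩
  · exact .inr ⟨a, ha, b, hb, hab, .inl h⟩
  · exact .inl ⟨a, ha, b, hb, hab, .inr h⟩
  · exact .inr ⟨a, ha, b, hb, hab, .inr h⟩

lemma count_coverPhase_le {k : ℕ} (hk : G.vertexCoverNum = (k : ℕ∞)) :
    count n (InCover (coverPhase (input G χ))) ≤ 2 * k := by
  classical
  have hr0 : (squared G χ).reg 0 = n := by simp [squared, assign, input]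
  have h2 : (squared G χ).reg 2 = (squared G χ).reg 0 * (squared G χ).reg 0 := by
    simp [squared, assign, input]
  have h3 : ∀ e, (squared G χ).arr 3 e = 0 := by simp [squared, assign, input]
  obtain ⟨Y, hYk, hY⟩ := G.vertexCoverNum_exists
  rw [hk] at hYk
  have hYfin : Y.toFinset.card = k := by
    rw [Set.encard_eq_coe_toFinset_card] at hYk
    exact_mod_cast hYk
  rw [← card_filter_fin, ← hYfin]
  refine le_trans (card_le_card ?_) (card_endpoints_le (G := G) (Y := Y.toFinset)
    (A := {p : Fin n × Fin n | Matched (fill 3 2 matchStep (squared G χ)) p.1 p.2}) ?_ ?_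
    (by simpa using hY))
  · intro v hv
    simp only [mem_filter, mem_univ, true_and] at hv
    obtain ⟨a, ha, b, hb, hab, hs⟩ := (inCover_coverPhase G χ v.2).1 hv
    simp only [mem_union, mem_image, mem_filter, mem_univ, true_and]
    rcases hs with rfl | rfl
    · exact .inl ⟨(v, ⟨b, hb⟩), hab, rfl⟩
    · exact .inr ⟨(⟨a, ha⟩, v), hab, rfl⟩
  · intro p hp
    simp only [mem_filter, mem_univ, true_and] at hp
    exact (adjacent_input G χ p.1 p.2).1 ((matched_fill_iff h2 h3 (hr0.symm ▸ p.1.2)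
      (hr0.symm ▸ p.2.2)).1 hp).1
  · intro p hp q hq hs
    simp only [mem_filter, mem_univ, true_and] at hp hq
    simp only [Fin.ext_iff] at hs
    obtain ⟨e1, e2⟩ := matched_disjoint h2 h3 (hr0.symm ▸ p.1.2) (hr0.symm ▸ p.2.2)
      (hr0.symm ▸ q.1.2) (hr0.symm ▸ q.2.2) hp hq hs
    exact Prod.ext (Fin.ext e1) (Fin.ext e2)

/-- The constant 512 = 8 ^ 3 is needed for k = 1 and also covers k = 0, where the power of k is 1.
For k ≥ 2, 4k + 4 ≤ k ^ 4 and 4(2k + 1) ≤ 12k. -/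
lemma base_pow_le {K k : ℕ} (h : K ≤ 2 * k) : (2 * K + 4) ^ (K + 1) ≤ 512 * k ^ (12 * k) := by
  have h1 : (2 * K + 4) ^ (K + 1) ≤ (4 * k + 4) ^ (2 * k + 1) :=
    (Nat.pow_le_pow_left (by omega) _).trans (Nat.pow_le_pow_right (by omega) (by omega))
  refine h1.trans ?_
  obtain rfl | rfl | hk : k = 0 ∨ k = 1 ∨ 2 ≤ k := by omega
  · norm_num
  · norm_num
  · have h2 : 4 * k + 4 ≤ k ^ 4 := by
      have : 2 ^ 3 ≤ k ^ 3 := Nat.pow_le_pow_left hk 3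
      rw [pow_succ]
      nlinarith
    calc _ ≤ (k ^ 4) ^ (2 * k + 1) := Nat.pow_le_pow_left h2 _
      _ = k ^ (8 * k + 4) := by rw [← pow_mul]; ring_nf
      _ ≤ k ^ (12 * k) := Nat.pow_le_pow_right (by omega) (by omega)
      _ ≤ _ := Nat.le_mul_of_pos_left _ (by norm_num)

lemma ready_prepared :
    Ready G χ (count n (InCover (coverPhase (input G χ)))) (prepared (input G χ)) := by
  set m := input G χ with hm
  set K := count n (InCover (coverPhase m)) with hK
  have hr0 : (coverPhase m).reg 0 = n := by simp [coverPhase, assign, hm, input]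
  have hr1 : (coverPhase m).reg 1 = c := by simp [coverPhase, assign, hm, input]
  have hr2 : (coverPhase m).reg 2 = n * n := by simp [coverPhase, assign, hm, input]
  have ha0 : (coverPhase m).arr 0 = m.arr 0 := by simp [coverPhase, assign, arr_fill_of_ne]
  have ha1 : (coverPhase m).arr 1 = m.arr 1 := by simp [coverPhase, assign, arr_fill_of_ne]
  have hsa : ∀ a, (sizePhase (coverPhase m)).arr a = (coverPhase m).arr a := fun _ => rfl
  have hs0 : (sizePhase (coverPhase m)).reg 0 = n := by simp [sizePhase, assign, hr0]
  have hs1 : (sizePhase (coverPhase m)).reg 1 = c := by simp [sizePhase, assign, hr1]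
  have hs2 : (sizePhase (coverPhase m)).reg 2 = n * n := by simp [sizePhase, assign, hr2]
  have hs3 : (sizePhase (coverPhase m)).reg 3 = K := by simp [sizePhase, assign, hr0, hK]
  have hs4 : (sizePhase (coverPhase m)).reg 4 = 2 * K + 1 := by
    simp [sizePhase, assign, hr0, hK, two_mul]
  have hs5 : (sizePhase (coverPhase m)).reg 5 = 2 * K + 4 := by
    simp [sizePhase, assign, hr0, hK, two_mul]
  have hs6 : (sizePhase (coverPhase m)).reg 6 = K + 1 := by simp [sizePhase, assign, hr0, hK]
  have hs7 : (sizePhase (coverPhase m)).reg 7 = K + 2 := by simp [sizePhase, assign, hr0, hK]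
  have hs8 : (sizePhase (coverPhase m)).reg 8 = (2 * K + 1) * (n * n) := by
    simp [sizePhase, assign, hr0, hr2, hK, two_mul]
  have hadj : ∀ u v : Fin n, Adjacent (sizePhase (coverPhase m)) u v ↔ G.Adj u v := by
    intro u v
    rw [← adjacent_input G χ u v, ← hm, Adjacent, hs0, hsa, ha1]
    rfl
  have hpow : ∀ j ≤ K + 1, (prepared m).arr 6 j = (2 * K + 4) ^ j := by
    intro j hj
    have := arr_fill_pow (m := fill 5 8 reachStep (sizePhase (coverPhase m))) (j := j)
    simp only [fill_reg, hs7, hs5] at this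
    exact this (by omega)
  have hcov : InCover (prepared m) = InCover (coverPhase m) := by
    funext v
    simp only [InCover, prepared, tablePhase, assign]
    rw [arr_fill_of_ne _ _ _ _ (by norm_num), arr_fill_of_ne _ _ _ _ (by norm_num), hsa]
  constructor
  · simp [prepared, tablePhase, assign, hs0]
  · simp [prepared, tablePhase, assign, hs1]
  · simp [prepared, tablePhase, assign, hs3]
  · simp [prepared, tablePhase, assign, hs4]
  · simp [prepared, tablePhase, assign, hs5]
  · simp [prepared, tablePhase, assign, hs6]
  · rw [← hpow _ le_rfl]
    simp [prepared, tablePhase, assign, hs6]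
  · simp [prepared, tablePhase, assign, hs0]
  · intro v
    have : (prepared m).arr 0 = m.arr 0 := by
      simp [prepared, tablePhase, assign, arr_fill_of_ne, hsa, ha0]
    rw [this]
    simp [hm, input]
  · intro u v
    have : (prepared m).arr 1 = (sizePhase (coverPhase m)).arr 1 := by
      simp [prepared, tablePhase, assign, arr_fill_of_ne]
    rw [← hadj u v, Adjacent, Adjacent, this]
    simp [prepared, tablePhase, assign]
  · rw [hcov]
  · rw [hcov]
    exact isVertexCover_coverPhase G χ
  · intro t ht u v
    rw [← reached_iff_edist (m := sizePhase (coverPhase m)) (by rw [hs0, hs2])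
      (by rw [hs8, hs4, hs2]) hs0 hadj (by rwa [hs4]) u v]
    simp [Reached, prepared, tablePhase, assign, arr_fill_of_ne]
  · exact hpow

lemma weight_prepared {k : ℕ} (hk : G.vertexCoverNum = (k : ℕ∞)) :
    weight (prepared (input G χ)) ≤ 20480 * k ^ (12 * k) * (n + c + 1) ^ 3 := by
  have hKk := count_coverPhase_le G χ hk
  have h := ready_prepared G χ
  have h2 : (prepared (input G χ)).reg 2 = n * n := by
    simp [prepared, tablePhase, sizePhase, coverPhase, assign, input]
  have h7 : (prepared (input G χ)).reg 7 = (prepared (input G χ)).reg 3 + 2 := by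
    simp [prepared, tablePhase, sizePhase, assign]
  have h8 : (prepared (input G χ)).reg 8 =
      (prepared (input G χ)).reg 4 * (prepared (input G χ)).reg 2 := by
    simp [prepared, tablePhase, sizePhase, assign]
  have h11 : ∀ r, 10 < r → (prepared (input G χ)).reg r = 0 := by
    intro r hr
    have hne : ∀ r' ≤ 10, r ≠ r' := fun r' hr' => by omega
    simp [prepared, tablePhase, sizePhase, coverPhase, assign, input, hne]
  set K := count n (InCover (coverPhase (input G χ))) with hK
  have hKn : K ≤ n := by
    classical
    exact (card_filter_le _ _).trans_eq (card_range n)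
  rw [h.reg3] at h7
  rw [h.reg4, h2] at h8
  have hA := base_pow_le hKk
  have hA1 : 1 ≤ (2 * K + 4) ^ (K + 1) := Nat.one_le_pow _ _ (by omega)
  set A := (2 * K + 4) ^ (K + 1) with hAdef
  have hw : weight (prepared (input G χ)) =
      1 + (n + c + n * n + K + (2 * K + 1) + (2 * K + 4) + (K + 1) + (K + 2) +
        (2 * K + 1) * (n * n) + A + (n + 1)) := by
    simp [weight, sum_range_succ, h.reg0, h.reg1, h2, h.reg3, h.reg4, h.reg5, h.reg6, h7, h8,
      h.reg9, h.reg10, h11, hAdef]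
  rw [hw]
  set N := n + c + 1 with hN
  have hN2 : N ≤ N * N := Nat.le_mul_self N
  have hN3 : N * N ≤ N * (N * N) := Nat.le_mul_of_pos_left _ (by omega)
  have hn2 : n * n ≤ N * N := Nat.mul_le_mul (by omega) (by omega)
  have hKn2 : K * (n * n) ≤ N * (N * N) := Nat.mul_le_mul (by omega) hn2
  have hA3 : A ≤ N * (N * N) * A := Nat.le_mul_of_pos_left _ (by omega)
  have hN3A : N * (N * N) ≤ N * (N * N) * A := Nat.le_mul_of_pos_right _ (by omega)
  have hNA : N * (N * N) * A ≤ N * (N * N) * (512 * k ^ (12 * k)) := Nat.mul_le_mul_left _ hA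
  -- The cube comes from the size (2K + 1) · n² of the reachability table. The factor 40 is
  -- generous, and 40 · 512 = 20480.
  calc _ ≤ 40 * (N * (N * N) * A) := by
        have : (2 * K + 1) * (n * n) = 2 * (K * (n * n)) + n * n := by ring
        omega
    _ ≤ 40 * (N * (N * N) * (512 * k ^ (12 * k))) := Nat.mul_le_mul_left _ hNA
    _ = _ := by ring

end Prepared

end MCS

theorem mainTheorem1 :
    ∃ (P : RAM.Program) (α β δ : ℕ),
      ∀ (n c : ℕ) (G : SimpleGraph (Fin n)) (χ : Fin n → Fin c) (k : ℕ),
        G.vertexCoverNum = (k : ℕ∞) →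
          ∃ (s : RAM.State) (t : ℕ) (S : Finset (Fin n)),
            RAM.Runs P (MCS.input G χ) s t ∧
            t ≤ α * k ^ (β * k) * (n + c + 1) ^ δ ∧
            MCS.IsOutput s S ∧
            MCS.IsMinimumConsistent G χ S := by
  classical
  obtain ⟨-, P, C, e, hP⟩ := MCS.achieves_output
    (ι := Σ n : ℕ, Σ c : ℕ, SimpleGraph (Fin n) × (Fin n → Fin c))
    (a := fun i => MCS.input i.2.2.1 i.2.2.2) (by
      intro i r hr
      simp [MCS.input, (show r ≠ 0 by omega), (show r ≠ 1 by omega)])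
  -- The time is at most C times the e-th power of the weight, and the constants are those of
  -- `weight_prepared` raised to the power e.
  refine ⟨P, C * 20480 ^ e, 12 * e, 3 * e, fun n c G χ k hk => ?_⟩
  obtain ⟨s, t, hrun, ht, hs⟩ := hP ⟨n, c, G, χ⟩ (MCS.input G χ) ⟨rfl, fun _ _ => rfl⟩
  have hready := MCS.ready_prepared G χ
  refine ⟨s, t, _, hrun, ?_, ?_, hready.isMinimumConsistent⟩
  · refine ht.trans ?_
    rw [RAM.weight_fill]
    refine (Nat.mul_le_mul_left _ (Nat.pow_le_pow_left (MCS.weight_prepared G χ hk) e)).trans_eq ?_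
    rw [mul_pow, mul_pow, ← pow_mul, ← pow_mul]
    ring_nf
  · intro v
    rw [hs.1]
    dsimp only
    -- Entry v is computed after earlier entries of array 2 have been written, but the search never
    -- reads that array.
    rw [RAM.fill, RAM.fillUpTo_arr_of_lt _ _ _ (by rw [hready.reg0]; exact v.2),
      MCS.outStep_congr (m := MCS.prepared (MCS.input G χ)) (RAM.fillUpTo_reg _ _ _ _)
        fun a ha => RAM.fillUpTo_arr_of_ne _ _ _ _ ha, MCS.outStep, hready.color v]
    simp
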